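/- Theorem (generating function for the Hagedorn wave packets). Let $d\in\mathbb N_0$, $\hbar>0$, let $Q,P\in M_d(\mathbb C)$ be such that $S=\begin{bmatrix}\operatorname{Re}Q&\operatorname{Im}Q\\ \operatorname{Re}P&\operatorname{Im}P\end{bmatrix}\in \mathsf{Sp}(2d,\mathbb R)$, let $z=(q,p)\in\mathbb R^d\times\mathbb R^d$, and let $(\widehat T_zf)(x)=e^{\frac{i}{\hbar}p\cdot(x-q/2)}f(x-q)$ on $L^2(\mathbb R^d)$. Let $\widehat S$ be a metaplectic operator over $S$: the metaplectic group $\mathsf{Mp}(2d,\mathbb R)$ is the group of unitary operators on $L^2(\mathbb R^d)$ generated by $\widehat J\psi(x)=(2\pi\hbar i)^{-d/2}\int e^{-\frac i\hbar x\cdot y}\psi(y)\,dy$, $\widehat V_R\psi(x)=e^{\frac{i}{2\hbar}x^TRx}\psi(x)$ ($R$ real symmetric) and $\widehat M^m_L\psi(x)=i^m\sqrt{|\det L|}\,\psi(Lx)$ ($L\in \mathsf{GL}(d,\mathbb R)$, $m\in\mathbb Z$, $m\pi\equiv\arg\det L$ mod $2\pi$), and its projection onto $\mathsf{Sp}(2d,\mathbb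 R)$ is the homomorphism with $\widehat J\mapsto\begin{bmatrix}0&I\\-I&0\end{bmatrix}$, $\widehat V_R\mapsto\begin{bmatrix}I&0\\R&I\end{bmatrix}$, $\widehat M^m_L\mapsto\begin{bmatrix}L^{-1}&0\\0&L^T\end{bmatrix}$. Then $Q$ is invertible, and there is exactly one family $(\varphi_n)_{n\in\mathbb N_0^d}$ of Schwartz functions (the Hagedorn wave packets) with $$\varphi_0=e^{-\frac{i}{2\hbar}p\cdot q}\,\widehat T_z\widehat S\psi_0,\qquad \psi_0(x)=(\pi\hbar)^{-d/4}e^{-x^2/(2\hbar)},$$ $$\varphi_{n+e_j}=\frac{1}{\sqrt{n_j+1}}\,\mathscr A_j^*\varphi_n,\qquad \mathscr A^*=\frac{i}{\sqrt{2\hbar}}\bigl[P^*(\hat x-q)-Q^*(\hat p-p)\bigr],$$ where $\hat x_kf=x_kf$ and $\hat p_kf=-i\hbar\,\partial_{x_k}f$. For one of the two values of $(\det Q)^{-1/2}$ (depending on $\widehat S$), $$\varphi_0(x)=\frac{(\det Q)^{-1/2}}{(\pi\hbar)^{d/4}}\exp\Bigl\{\frac i\hbar\Bigl[\tfrac12(x-q)^TPQ^{-1}(x-q)+p\cdot(x-q)\Bigr]\Bigr\},$$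 and in particular $\varphi_0$ has no zeros. For $w\in\mathbb C^d$ let $$\Gamma(w,x)=(\pi\hbar)^{-d/4}\exp\Bigl(-\frac{x^2}{2\hbar}+\frac{2}{\sqrt\hbar}w^Tx-w^2\Bigr),\qquad w^2=w^Tw,$$ be the generating function of the Hermite functions. Then $$\Gamma(S,z;w,\cdot):=e^{-\frac{i}{2\hbar}p\cdot q}\,\widehat T_z\widehat S\,\Gamma(w,\cdot)$$ is (the $L^2$-class of) a Schwartz function and, for all $w\in\mathbb C^d$ and $x\in\mathbb R^d$, $$\Gamma(S,z;w,x)=\varphi_0(x)\exp\Bigl(\frac{2}{\sqrt\hbar}w^TQ^{-1}(x-q)-w^TQ^{-1}\overline Q\,w\Bigr)=\sum_{n\in\mathbb N_0^d}\varphi_n(x)\,\frac{c_n}{n!}\,w^n,\qquad c_n=\sqrt{2^{|n|}n!},$$ $$\gamma(S,z;w,x):=\frac{\Gamma(S,z;w,x)}{\varphi_0(x)}=\exp\Bigl(\frac{2}{\sqrt\hbar}w^TQ^{-1}(x-q)-w^TQ^{-1}\overline Q\,w\Bigr)=\sum_{n\in\mathbb N_0^d}\mathcal P_n(x)\,\frac{w^n}{n!},$$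 where $\mathcal P_n=c_n\varphi_n/\varphi_0$ are the Hagedorn polynomials. Both series converge unconditionally. -/

import Mathlib

open MeasureTheory SchwartzMap Matrix
open scoped ENNReal SchwartzMap FourierTransform

noncomputable section

namespace Hagedorn

/-- The configuration space `ℝ^d`. -/
abbrev Space (d : ℕ) : Type := EuclideanSpace ℝ (Fin d)

/-- The Hilbert space `L²(ℝ^d)`. -/
abbrev L2 (d : ℕ) : Type := Lp ℂ 2 (volume : Measure (Space d))

/-- The group of unitary operators on `L²(ℝ^d)`. -/
abbrev UnitaryOp (d : ℕ) : Type := L2 d ≃ₗᵢ[ℂ] L2 d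

variable {d : ℕ}

theorem eLpNorm_weightedComp {a : Space d → ℂ} {c : ℝ} (hc : 0 < c) (hac : ∀ x, ‖a x‖ = c)
    (τ : Space d ≃ₜ Space d)
    (hτ : (volume : Measure (Space d)).map τ = ENNReal.ofReal (c ^ 2)⁻¹ • volume)
    {f : Space d → ℂ} (hf : AEStronglyMeasurable f volume) :
    eLpNorm (fun x => a x * f (τ x)) 2 volume = eLpNorm f 2 volume := by
  have h1 : eLpNorm (fun x => a x * f (τ x)) 2 volume
      = eLpNorm ((c : ℂ) • (f ∘ τ)) 2 volume := by
    refine eLpNorm_congr_norm_ae (ae_of_all _ fun x => ?_)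
    simp [hac, abs_of_pos hc]
  have h2 : eLpNorm (f ∘ τ) 2 volume
      = ENNReal.ofReal (c ^ 2)⁻¹ ^ (1 / (2 : ℝ≥0∞)).toReal * eLpNorm f 2 volume := by
    rw [← eLpNorm_map_measure (μ := volume) (f := τ) (g := f) _ τ.continuous.aemeasurable, hτ,
      eLpNorm_smul_measure_of_ne_top (by simp), smul_eq_mul]
    rw [hτ]
    exact hf.smul_measure _
  rw [h1, eLpNorm_const_smul, h2, ← mul_assoc]
  have h3 : ‖(c : ℂ)‖ₑ = ENNReal.ofReal c := by
    rw [← ofReal_norm]; simp [abs_of_pos hc]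
  have h4 : ENNReal.ofReal (c ^ 2)⁻¹ ^ (1 / (2 : ℝ≥0∞)).toReal = ENNReal.ofReal c⁻¹ := by
    rw [ENNReal.ofReal_rpow_of_pos (by positivity)]
    congr 1
    have : (1 / (2 : ℝ≥0∞)).toReal = 1 / 2 := by simp
    rw [this, ← Real.sqrt_eq_rpow, ← inv_pow, Real.sqrt_sq (by positivity)]
  rw [h3, h4, ← ENNReal.ofReal_mul hc.le, mul_inv_cancel₀ hc.ne', ENNReal.ofReal_one, one_mul]

theorem quasiMeasurePreserving_of_map {c : ℝ} (τ : Space d ≃ₜ Space d)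
    (hτ : (volume : Measure (Space d)).map τ = ENNReal.ofReal (c ^ 2)⁻¹ • volume) :
    Measure.QuasiMeasurePreserving τ (volume : Measure (Space d)) volume :=
  ⟨τ.continuous.measurable, hτ ▸ Measure.smul_absolutelyContinuous⟩

theorem memLp_weightedComp {a : Space d → ℂ} (ha : Continuous a) {c : ℝ} (hc : 0 < c)
    (hac : ∀ x, ‖a x‖ = c) (τ : Space d ≃ₜ Space d)
    (hτ : (volume : Measure (Space d)).map τ = ENNReal.ofReal (c ^ 2)⁻¹ • volume) (f : L2 d) :
    MemLp (fun x => a x * f (τ x)) 2 (volume : Measure (Space d)) :=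
  ⟨ha.aestronglyMeasurable.mul ((Lp.aestronglyMeasurable f).comp_quasiMeasurePreserving
      (quasiMeasurePreserving_of_map τ hτ)),
    by rw [eLpNorm_weightedComp hc hac τ hτ (Lp.aestronglyMeasurable f)]
       exact (Lp.memLp f).2⟩

/-- The isometry `f ↦ (x ↦ a x * f (τ x))` of `L²(ℝ^d)`, where `|a|` is a constant `c > 0` and the
homeomorphism `τ` pushes Lebesgue measure forward to `c⁻²` times itself. -/
def weightedCompIsometry (a : Space d → ℂ) (ha : Continuous a) (c : ℝ) (hc : 0 < c)
    (hac : ∀ x, ‖a x‖ = c) (τ : Space d ≃ₜ Space d)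
    (hτ : (volume : Measure (Space d)).map τ = ENNReal.ofReal (c ^ 2)⁻¹ • volume) :
    L2 d →ₗᵢ[ℂ] L2 d where
  toFun f := (memLp_weightedComp ha hc hac τ hτ f).toLp
  map_add' f g := by
    apply Lp.ext
    filter_upwards [(memLp_weightedComp ha hc hac τ hτ (f + g)).coeFn_toLp,
      (memLp_weightedComp ha hc hac τ hτ f).coeFn_toLp,
      (memLp_weightedComp ha hc hac τ hτ g).coeFn_toLp,
      Lp.coeFn_add (memLp_weightedComp ha hc hac τ hτ f).toLp
        (memLp_weightedComp ha hc hac τ hτ g).toLp,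
      (quasiMeasurePreserving_of_map τ hτ).ae (Lp.coeFn_add f g)] with x h1 h2 h3 h4 h5
    rw [h1, h4, Pi.add_apply, h2, h3, h5, Pi.add_apply, mul_add]
  map_smul' k f := by
    apply Lp.ext
    filter_upwards [(memLp_weightedComp ha hc hac τ hτ (k • f)).coeFn_toLp,
      (memLp_weightedComp ha hc hac τ hτ f).coeFn_toLp,
      Lp.coeFn_smul k (memLp_weightedComp ha hc hac τ hτ f).toLp,
      (quasiMeasurePreserving_of_map τ hτ).ae (Lp.coeFn_smul k f)] with x h1 h2 h4 h5
    simp only [RingHom.id_apply]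
    rw [h1, h4, Pi.smul_apply, h2, h5, Pi.smul_apply, smul_eq_mul, smul_eq_mul]
    ring
  norm_map' f := by
    simp only [LinearMap.coe_mk, AddHom.coe_mk]
    rw [Lp.norm_toLp, eLpNorm_weightedComp hc hac τ hτ (Lp.aestronglyMeasurable f), Lp.norm_def]

theorem surjective_weightedCompIsometry (a : Space d → ℂ) (ha : Continuous a) (c : ℝ) (hc : 0 < c)
    (hac : ∀ x, ‖a x‖ = c) (τ : Space d ≃ₜ Space d)
    (hτ : (volume : Measure (Space d)).map τ = ENNReal.ofReal (c ^ 2)⁻¹ • volume) :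
    Function.Surjective (weightedCompIsometry a ha c hc hac τ hτ) := by
  intro g
  have ha0 : ∀ x, a x ≠ 0 := fun x h => by have := hac x; simp [h] at this; linarith
  have hτ' : (volume : Measure (Space d)).map τ.symm
      = ENNReal.ofReal ((c⁻¹) ^ 2)⁻¹ • volume := by
    have h : ((volume : Measure (Space d)).map τ).map τ.symm = volume := by
      rw [Measure.map_map τ.symm.continuous.measurable τ.continuous.measurable]
      simp
    rw [hτ, Measure.map_smul] at h
    have h2 : ENNReal.ofReal ((c⁻¹) ^ 2)⁻¹ • (ENNReal.ofReal (c ^ 2)⁻¹ •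
      (volume : Measure (Space d)).map τ.symm) = ENNReal.ofReal ((c⁻¹) ^ 2)⁻¹ • volume := by rw [h]
    rw [smul_smul, ← ENNReal.ofReal_mul (by positivity)] at h2
    rw [← h2]
    have : ((c⁻¹) ^ 2)⁻¹ * (c ^ 2)⁻¹ = 1 := by field_simp
    rw [this]; simp
  have hac' : ∀ x, ‖(a (τ.symm x))⁻¹‖ = c⁻¹ := fun x => by rw [norm_inv, hac]
  have ha' : Continuous fun x => (a (τ.symm x))⁻¹ :=
    (ha.comp τ.symm.continuous).inv₀ fun x => ha0 _
  have hc' : 0 < c⁻¹ := inv_pos.mpr hc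
  refine ⟨weightedCompIsometry _ ha' c⁻¹ hc' hac' τ.symm hτ' g, ?_⟩
  apply Lp.ext
  filter_upwards [(memLp_weightedComp ha hc hac τ hτ
      (weightedCompIsometry _ ha' c⁻¹ hc' hac' τ.symm hτ' g)).coeFn_toLp,
    (quasiMeasurePreserving_of_map τ hτ).ae
      (memLp_weightedComp ha' hc' hac' τ.symm hτ' g).coeFn_toLp] with x h1 h2
  refine h1.trans ?_
  refine (congrArg (a x * ·) h2).trans ?_
  simp only [τ.symm_apply_apply]
  rw [← mul_assoc, mul_inv_cancel₀ (ha0 x), one_mul]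

/-- The unitary operator `f ↦ (x ↦ a x * f (τ x))` of `L²(ℝ^d)`. -/
def weightedComp (a : Space d → ℂ) (ha : Continuous a) (c : ℝ) (hc : 0 < c)
    (hac : ∀ x, ‖a x‖ = c) (τ : Space d ≃ₜ Space d)
    (hτ : (volume : Measure (Space d)).map τ = ENNReal.ofReal (c ^ 2)⁻¹ • volume) :
    UnitaryOp d :=
  LinearIsometryEquiv.ofSurjective (weightedCompIsometry a ha c hc hac τ hτ)
    (surjective_weightedCompIsometry a ha c hc hac τ hτ)

theorem coeFn_weightedComp (a : Space d → ℂ) (ha : Continuous a) (c : ℝ) (hc : 0 < c)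
    (hac : ∀ x, ‖a x‖ = c) (τ : Space d ≃ₜ Space d)
    (hτ : (volume : Measure (Space d)).map τ = ENNReal.ofReal (c ^ 2)⁻¹ • volume) (f : L2 d) :
    weightedComp a ha c hc hac τ hτ f =ᵐ[volume] fun x => a x * f (τ x) :=
  (memLp_weightedComp ha hc hac τ hτ f).coeFn_toLp

/-- Multiplication by the phase `exp (i θ(x))`. -/
def phaseOp (θ : Space d → ℝ) (hθ : Continuous θ) : UnitaryOp d :=
  weightedComp (fun x => Complex.exp ((θ x : ℂ) * Complex.I)) (by fun_prop) 1 one_pos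
    (fun x => Complex.norm_exp_ofReal_mul_I _) (Homeomorph.refl _) (by simp)

/-- The operator `V_R ψ(x) = exp (i xᵀRx / (2ħ)) ψ(x)`. -/
def opV (ħ : ℝ) (R : Matrix (Fin d) (Fin d) ℝ) : UnitaryOp d :=
  phaseOp (fun x => (1 / (2 * ħ)) * (x.ofLp ⬝ᵥ (R *ᵥ x.ofLp)))
    (by simp only [dotProduct, mulVec]; fun_prop)

theorem coeFn_opV (ħ : ℝ) (R : Matrix (Fin d) (Fin d) ℝ) (f : L2 d) :
    opV ħ R f =ᵐ[volume] fun x =>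
      Complex.exp (((1 / (2 * ħ) * (x.ofLp ⬝ᵥ (R *ᵥ x.ofLp)) : ℝ) : ℂ) * Complex.I) * f x :=
  coeFn_weightedComp _ _ _ _ _ _ _ f

/-- The homeomorphism `x ↦ L x` of `ℝ^d`. -/
def linHomeo (L : GL (Fin d) ℝ) : Space d ≃ₜ Space d where
  toFun x := WithLp.toLp 2 (L.1 *ᵥ x.ofLp)
  invFun x := WithLp.toLp 2 (L⁻¹.1 *ᵥ x.ofLp)
  left_inv x := by simp [mulVec_mulVec]
  right_inv x := by simp [mulVec_mulVec]
  continuous_toFun := by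
    change Continuous (Matrix.toEuclideanLin L.1)
    exact LinearMap.continuous_of_finiteDimensional _
  continuous_invFun := by
    change Continuous (Matrix.toEuclideanLin L⁻¹.1)
    exact LinearMap.continuous_of_finiteDimensional _

theorem map_linHomeo (L : GL (Fin d) ℝ) :
    (volume : Measure (Space d)).map (linHomeo L)
      = ENNReal.ofReal (√|L.1.det| ^ 2)⁻¹ • volume := by
  have hL : L.1.det ≠ 0 := ((Matrix.isUnit_iff_isUnit_det _).mp L.isUnit).ne_zero
  have hdet : LinearMap.det (Matrix.toEuclideanLin L.1) = L.1.det := by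
    rw [Matrix.toEuclideanLin_eq_toLin_orthonormal, LinearMap.det_toLin]
  have h := Measure.map_linearMap_addHaar_eq_smul_addHaar (μ := (volume : Measure (Space d)))
    (f := Matrix.toEuclideanLin L.1) (by rwa [hdet])
  rw [hdet, abs_inv] at h
  rw [Real.sq_sqrt (abs_nonneg _)]
  exact h

/-- The operator `M_L^m ψ(x) = i^m √|det L| ψ(L x)`. -/
def opM (L : GL (Fin d) ℝ) (m : ℤ) : UnitaryOp d :=
  weightedComp (fun _ => Complex.I ^ m * (√|L.1.det| : ℝ)) continuous_const √|L.1.det|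
    (Real.sqrt_pos.mpr (abs_pos.mpr ((Matrix.isUnit_iff_isUnit_det _).mp L.isUnit).ne_zero))
    (fun _ => by simp [abs_of_nonneg (Real.sqrt_nonneg _)])
    (linHomeo L) (map_linHomeo L)

theorem coeFn_opM (L : GL (Fin d) ℝ) (m : ℤ) (f : L2 d) :
    opM L m f =ᵐ[volume] fun x =>
      Complex.I ^ m * (√|L.1.det| : ℝ) * f (WithLp.toLp 2 (L.1 *ᵥ x.ofLp)) :=
  coeFn_weightedComp _ _ _ _ _ _ _ f

/-- The Heisenberg-Weyl operator `T_z ψ(x) = exp (i p·(x - q/2) / ħ) ψ(x - q)`, `z = (q, p)`. -/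
def opT (ħ : ℝ) (q p : Space d) : UnitaryOp d :=
  weightedComp
    (fun x => Complex.exp (((1 / ħ * inner ℝ p (x - (1 / 2 : ℝ) • q) : ℝ) : ℂ) * Complex.I))
    (by fun_prop) 1 one_pos (fun x => Complex.norm_exp_ofReal_mul_I _)
    (Homeomorph.subRight q)
    (by simpa using (measurePreserving_sub_right (volume : Measure (Space d)) q).map_eq)

theorem coeFn_opT (ħ : ℝ) (q p : Space d) (f : L2 d) :
    opT ħ q p f =ᵐ[volume] fun x =>
      Complex.exp (((1 / ħ * inner ℝ p (x - (1 / 2 : ℝ) • q) : ℝ) : ℂ) * Complex.I) * f (x - q) :=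
  coeFn_weightedComp _ _ _ _ _ _ _ f

/-- The rescaling `ψ(x) ↦ (2πħi)^(-d/2) ψ(x / (2πħ))`. -/
def fourierRescale {ħ : ℝ} (hħ : 0 < ħ) : UnitaryOp d :=
  weightedComp (fun _ => ((2 * Real.pi * ħ * Complex.I : ℂ) ^ ((d : ℂ) / 2))⁻¹) continuous_const
    ((2 * Real.pi * ħ) ^ ((d : ℝ) / 2))⁻¹ (by positivity)
    (fun _ => by
      have h0 : (2 * Real.pi * ħ * Complex.I : ℂ) ≠ 0 := by
        simp [Real.pi_ne_zero, hħ.ne']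
      rw [norm_inv, Complex.norm_cpow_of_ne_zero h0]
      have h1 : ((d : ℂ) / 2).im = 0 := by
        rw [show ((d : ℂ) / 2) = (((d : ℝ) / 2 : ℝ) : ℂ) by push_cast; rfl, Complex.ofReal_im]
      have h2 : ((d : ℂ) / 2).re = (d : ℝ) / 2 := by
        rw [show ((d : ℂ) / 2) = (((d : ℝ) / 2 : ℝ) : ℂ) by push_cast; rfl, Complex.ofReal_re]
      simp [h1, h2, abs_of_pos Real.pi_pos, abs_of_pos hħ])
    (Homeomorph.smulOfNeZero (2 * Real.pi * ħ)⁻¹ (by positivity))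
    (by
      have h := Measure.map_addHaar_smul (volume : Measure (Space d))
        (r := (2 * Real.pi * ħ)⁻¹) (by positivity)
      refine h.trans ?_
      congr 2
      have hp : 0 < 2 * Real.pi * ħ := by positivity
      rw [finrank_euclideanSpace, Fintype.card_fin, inv_pow, inv_inv, inv_pow, inv_inv,
        abs_of_pos (by positivity), ← Real.rpow_natCast (_ ^ _) 2, ← Real.rpow_mul hp.le]
      simp)

/-- The metaplectic operator `J = i^(-d/2) ℱ_ħ` on `L²(ℝ^d)`, i.e. `fourierRescale` after Mathlib's
Fourier transform (whose kernel is `exp (-2πi x·y)`). -/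
def opJ {ħ : ℝ} (hħ : 0 < ħ) : UnitaryOp d :=
  fourierRescale hħ * Lp.fourierTransformₗᵢ (Space d) ℂ

/-- On Schwartz functions `J` is given by the integral
`Jψ(x) = (2πħi)^(-d/2) ∫ exp (-i x·y / ħ) ψ(y) dy`. -/
theorem coeFn_opJ {ħ : ℝ} (hħ : 0 < ħ) (f : 𝓢(Space d, ℂ)) :
    opJ hħ (f.toLp 2 volume) =ᵐ[volume] fun x =>
      ((2 * Real.pi * ħ * Complex.I : ℂ) ^ ((d : ℂ) / 2))⁻¹ *
        ∫ y, Complex.exp (((-(1 / ħ * inner ℝ x y) : ℝ) : ℂ) * Complex.I) * f y := by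
  have hF : Lp.fourierTransformₗᵢ (Space d) ℂ (f.toLp 2 volume) = (𝓕 f).toLp 2 volume :=
    SchwartzMap.toLp_fourier_eq f
  have hmap : (volume : Measure (Space d)).map
      (Homeomorph.smulOfNeZero (2 * Real.pi * ħ)⁻¹ (by positivity) : Space d ≃ₜ Space d)
      ≪ volume := by
    have h := Measure.map_addHaar_smul (volume : Measure (Space d))
        (r := (2 * Real.pi * ħ)⁻¹) (by positivity)
    exact (h ▸ Measure.smul_absolutelyContinuous :
      (volume : Measure (Space d)).map ((2 * Real.pi * ħ)⁻¹ • ·) ≪ volume)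
  have hq : Measure.QuasiMeasurePreserving
      (Homeomorph.smulOfNeZero (2 * Real.pi * ħ)⁻¹ (by positivity) : Space d ≃ₜ Space d)
      (volume : Measure (Space d)) volume := ⟨(Homeomorph.continuous _).measurable, hmap⟩
  have h1 : opJ hħ (f.toLp 2 volume) = fourierRescale hħ ((𝓕 f).toLp 2 volume) := by
    rw [← hF]; rfl
  rw [h1]
  filter_upwards [coeFn_weightedComp _ _ _ _ _ _ _ ((𝓕 f).toLp 2 volume),
    hq.ae ((𝓕 f).coeFn_toLp 2 volume)] with x hx hx2
  refine hx.trans ?_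
  rw [hx2]
  congr 1
  rw [SchwartzMap.fourier_coe, Real.fourier_eq']
  refine integral_congr_ae (ae_of_all _ fun y => ?_)
  have : -2 * Real.pi * inner ℝ y ((Homeomorph.smulOfNeZero (2 * Real.pi * ħ)⁻¹
      (by positivity) : Space d ≃ₜ Space d) x) = -(1 / ħ * inner ℝ x y) := by
    change -2 * Real.pi * inner ℝ y ((2 * Real.pi * ħ)⁻¹ • x) = _
    rw [inner_smul_right, real_inner_comm]
    field_simp
  simp only [smul_eq_mul]
  rw [← this]

/-- The graph of the covering homomorphism `Mp(2d,ℝ) → Sp(2d,ℝ)`: the group generated by the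
operators `J`, `V_R` (`R` symmetric), `M_L^m` (`L` invertible, `mπ ≡ arg det L` modulo `2π`, i.e. `m`
is even exactly when `det L > 0`), each paired with its symplectic matrix. -/
def metaplecticGraph {ħ : ℝ} (hħ : 0 < ħ) :
    Subgroup (UnitaryOp d × symplecticGroup (Fin d) ℝ) :=
  Subgroup.closure
    ({g | g.1 = opJ hħ ∧ g.2.1 = fromBlocks 0 1 (-1) 0} ∪
     {g | ∃ R : Matrix (Fin d) (Fin d) ℝ, R.IsSymm ∧ g.1 = opV ħ R ∧
        g.2.1 = fromBlocks 1 0 R 1} ∪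
     {g | ∃ (L : GL (Fin d) ℝ) (m : ℤ), (Even m ↔ 0 < L.1.det) ∧ g.1 = opM L m ∧
        g.2.1 = fromBlocks L⁻¹.1 0 0 L.1ᵀ})

/-- The metaplectic group `Mp(2d,ℝ)`, a subgroup of the unitary group of `L²(ℝ^d)`. -/
def metaplecticGroup {ħ : ℝ} (hħ : 0 < ħ) : Subgroup (UnitaryOp d) :=
  (metaplecticGraph hħ).map (MonoidHom.fst _ _)

/-- `U` is a metaplectic operator that projects to the symplectic matrix `S`. -/
def IsMetaplecticLift {ħ : ℝ} (hħ : 0 < ħ) (U : UnitaryOp d) (S : symplecticGroup (Fin d) ℝ) :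
    Prop :=
  (U, S) ∈ metaplecticGraph hħ

/-- A real vector regarded as a complex one. -/
def cvec (x : Space d) : Fin d → ℂ := fun j => (x j : ℂ)

/-- The Gaussian `ψ_0(x) = (πħ)^(-d/4) exp (-x² / (2ħ))`. -/
def hermiteGround (ħ : ℝ) (x : Space d) : ℂ :=
  ((((Real.pi * ħ) ^ ((d : ℝ) / 4))⁻¹ : ℝ) : ℂ) * Complex.exp (-(‖x‖ : ℂ) ^ 2 / (2 * ħ))

/-- The generating function of the Hermite functions,
`Γ(w, x) = (πħ)^(-d/4) exp (-x² / (2ħ) + 2 ħ^(-1/2) wᵀx - w²)`. -/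
def hermiteGen (ħ : ℝ) (w : Fin d → ℂ) (x : Space d) : ℂ :=
  ((((Real.pi * ħ) ^ ((d : ℝ) / 4))⁻¹ : ℝ) : ℂ) *
    Complex.exp (-(‖x‖ : ℂ) ^ 2 / (2 * ħ) + 2 / (√ħ : ℂ) * (w ⬝ᵥ cvec x) - w ⬝ᵥ w)

theorem hermiteGen_zero (ħ : ℝ) : hermiteGen ħ (0 : Fin d → ℂ) = hermiteGround ħ := by
  funext x
  simp [hermiteGen, hermiteGround]

theorem continuous_hermiteGen (ħ : ℝ) (w : Fin d → ℂ) : Continuous (hermiteGen ħ w) := by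
  unfold hermiteGen cvec dotProduct
  fun_prop

theorem memLp_hermiteGen {ħ : ℝ} (hħ : 0 < ħ) (w : Fin d → ℂ) :
    MemLp (hermiteGen ħ w) 2 (volume : Measure (Space d)) := by
  rw [memLp_two_iff_integrable_sq_norm (continuous_hermiteGen ħ w).aestronglyMeasurable]
  have hb : 0 < (1 / ħ : ℂ).re := by
    rw [show (1 / ħ : ℂ) = ((1 / ħ : ℝ) : ℂ) by push_cast; rfl, Complex.ofReal_re]
    positivity
  have h1 : Integrable (fun x : Space d => Complex.exp (-(1 / ħ : ℂ) * ∑ i, (x i : ℂ) ^ 2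
      + ∑ i, (4 / (√ħ : ℂ) * w i) * x i)) := by
    rw [← (PiLp.volume_preserving_toLp (Fin d)).integrable_comp_emb
      (MeasurableEquiv.toLp 2 _).measurableEmbedding]
    exact GaussianFourier.integrable_cexp_neg_mul_sum_add hb _
  have h2 := (h1.const_mul (((((Real.pi * ħ) ^ ((d : ℝ) / 4))⁻¹ : ℝ) : ℂ) ^ 2
    * Complex.exp (-2 * (w ⬝ᵥ w)))).norm
  refine h2.congr (ae_of_all _ fun x => ?_)
  simp only
  rw [← norm_pow]
  congr 1
  rw [hermiteGen, mul_pow, mul_assoc, ← Complex.exp_add, ← Complex.exp_nat_mul]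
  congr 2
  have hn : (‖x‖ : ℂ) ^ 2 = ∑ i, (x i : ℂ) ^ 2 := by
    rw [← Complex.ofReal_pow, EuclideanSpace.norm_sq_eq]
    simp
  have hs : ∑ i, (4 / (√ħ : ℂ) * w i) * x i = 4 / (√ħ : ℂ) * (w ⬝ᵥ cvec x) := by
    rw [dotProduct, Finset.mul_sum]
    exact Finset.sum_congr rfl fun i _ => by rw [cvec]; ring
  have h0 : (ħ : ℂ) ≠ 0 := by exact_mod_cast hħ.ne'
  rw [hn, hs]
  field_simp
  push_cast
  ring

theorem memLp_hermiteGround {ħ : ℝ} (hħ : 0 < ħ) :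
    MemLp (hermiteGround ħ) 2 (volume : Measure (Space d)) :=
  hermiteGen_zero (d := d) ħ ▸ memLp_hermiteGen hħ 0

/-- The unitary operator `exp (-i p·q / (2ħ)) T_z U` applied to `f`. -/
def hagedornOp (ħ : ℝ) (q p : Space d) (U : UnitaryOp d) (f : L2 d) : L2 d :=
  Complex.exp (-(Complex.I / (2 * ħ)) * (inner ℝ p q : ℝ)) • opT ħ q p (U f)

/-- `Γ(S, z; w, ·) = exp (-i p·q / (2ħ)) T_z U Γ(w, ·)`. -/
def hagedornGen {ħ : ℝ} (hħ : 0 < ħ) (q p : Space d) (U : UnitaryOp d) (w : Fin d → ℂ) : L2 d :=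
  hagedornOp ħ q p U (memLp_hermiteGen hħ w).toLp

/-- The position operator `f ↦ x_k f` on Schwartz functions. -/
def positionOp (k : Fin d) : 𝓢(Space d, ℂ) →L[ℂ] 𝓢(Space d, ℂ) :=
  SchwartzMap.smulLeftCLM ℂ (fun x : Space d => (x k : ℂ))

/-- The momentum operator `f ↦ -iħ ∂f/∂x_k` on Schwartz functions. -/
def momentumOp (ħ : ℝ) (k : Fin d) : 𝓢(Space d, ℂ) →L[ℂ] 𝓢(Space d, ℂ) :=
  (-(Complex.I * ħ)) •
    LineDeriv.lineDerivOpCLM ℂ 𝓢(Space d, ℂ) (EuclideanSpace.single k (1 : ℝ))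

theorem positionOp_apply (k : Fin d) (f : 𝓢(Space d, ℂ)) (x : Space d) :
    positionOp k f x = (x k : ℂ) * f x := by
  have h : Function.HasTemperateGrowth (fun x : Space d => (x k : ℂ)) :=
    (Complex.ofRealCLM.comp (EuclideanSpace.proj k : Space d →L[ℝ] ℝ)).hasTemperateGrowth
  rw [positionOp, SchwartzMap.smulLeftCLM_apply_apply h, smul_eq_mul]

theorem momentumOp_apply (ħ : ℝ) (k : Fin d) (f : 𝓢(Space d, ℂ)) (x : Space d) :
    momentumOp ħ k f x =
      -(Complex.I * ħ) * lineDeriv ℝ f x (EuclideanSpace.single k (1 : ℝ)) := by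
  rw [← SchwartzMap.lineDerivOp_apply]
  rfl

/-- The `j`-th raising operator `i (2ħ)^(-1/2) [P^* (x - q) - Q^* (p̂ - p)]_j` for the symplectic
matrix with blocks `Re Q`, `Im Q`, `Re P`, `Im P` and the phase space point `z = (q, p)`. -/
def raisingOp (ħ : ℝ) (Q P : Matrix (Fin d) (Fin d) ℂ) (q p : Space d) (j : Fin d) :
    𝓢(Space d, ℂ) →L[ℂ] 𝓢(Space d, ℂ) :=
  (Complex.I / (√(2 * ħ) : ℂ)) • ∑ k, (Pᴴ j k • (positionOp k - (q k : ℂ) • 1)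
    - Qᴴ j k • (momentumOp ħ k - (p k : ℂ) • 1))

/-- `φ` is the family of wave packets `φ_n(S, z; ·)`, `n` a multi-index: the ground state is
`φ_0 = exp (-i p·q / (2ħ)) T_z U ψ_0`, and `φ_{n + e_j} = (n_j + 1)^(-1/2) A_j^* φ_n` for all `n`
and `j`. These conditions determine `φ`. -/
structure IsHagedornFamily {ħ : ℝ} (hħ : 0 < ħ) (Q P : Matrix (Fin d) (Fin d) ℂ)
    (q p : Space d) (U : UnitaryOp d) (φ : (Fin d → ℕ) → 𝓢(Space d, ℂ)) : Prop where
  ground : (φ 0).toLp 2 volume = hagedornOp ħ q p U (memLp_hermiteGround hħ).toLp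
  raise : ∀ (n : Fin d → ℕ) (j : Fin d),
    φ (n + Pi.single j 1) = (((√(n j + 1 : ℝ))⁻¹ : ℝ) : ℂ) • raisingOp ħ Q P q p j (φ n)

/-- `n! = ∏ n_j!`. -/
def multiFactorial (n : Fin d → ℕ) : ℕ := ∏ j, (n j).factorial

/-- `c_n = √(2^|n| n!)`. -/
def hermiteConst (n : Fin d → ℕ) : ℝ := √(2 ^ (∑ j, n j) * (multiFactorial n : ℝ))

/-- `w^n = ∏ w_j^{n_j}`. -/
def multiPow (w : Fin d → ℂ) (n : Fin d → ℕ) : ℂ := ∏ j, w j ^ n j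

/-- The polynomials `c_n φ_n / φ_0`. -/
def hagedornPolynomial (φ : (Fin d → ℕ) → 𝓢(Space d, ℂ)) (n : Fin d → ℕ) (x : Space d) : ℂ :=
  (hermiteConst n : ℂ) * (φ n x / φ 0 x)

/-- The closed form `(det Q)^(-1/2) (πħ)^(-d/4) exp ((i/ħ) [(x-q)ᵀ P Q⁻¹ (x-q) / 2 + p·(x-q)])` of
the ground state, where `σ` is the chosen value of `(det Q)^(-1/2)`. -/
def groundFormula (ħ : ℝ) (Q P : Matrix (Fin d) (Fin d) ℂ) (q p : Space d) (σ : ℂ)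
    (x : Space d) : ℂ :=
  σ * ((((Real.pi * ħ) ^ ((d : ℝ) / 4))⁻¹ : ℝ) : ℂ) *
    Complex.exp (Complex.I / ħ * (1 / 2 * (cvec (x - q) ⬝ᵥ ((P * Q⁻¹) *ᵥ cvec (x - q)))
      + (inner ℝ p (x - q) : ℝ)))

/-- `exp (2 ħ^(-1/2) wᵀ Q⁻¹ (x - q) - wᵀ Q⁻¹ Q̄ w)`. -/
def genFactor (ħ : ℝ) (Q : Matrix (Fin d) (Fin d) ℂ) (q : Space d) (w : Fin d → ℂ)
    (x : Space d) : ℂ :=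
  Complex.exp (2 / (√ħ : ℂ) * (w ⬝ᵥ (Q⁻¹ *ᵥ cvec (x - q)))
    - w ⬝ᵥ ((Q⁻¹ * Q.map (starRingEnd ℂ)) *ᵥ w))

end Hagedorn

end

noncomputable section

namespace Hagedorn

variable {d : ℕ}

/-! The proof has two independent halves.

Closed form. Call `(Q, P)` a normalized Lagrangian frame if `QᵀP = PᵀQ` and `Q^*P - P^*Q = 2i`.
Symplectic matrices act on frames from the left, and `S` carries `(1, i)` to the given `(Q, P)`.
Every frame has a Gaussian generating function in `(w, x)`, and that of `(1, i)` is the generating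
function of the Hermite functions. A metaplectic operator over `S` sends the Gaussian of a frame to
that of its image, up to a factor `κ` with `κ² det Q' = det Q` that does not depend on `w`
(`mapsGaussians_of_isMetaplecticLift`). This property passes to products and inverses, so it need
only be checked on generators: `V_R` and `M_L^m` act pointwise, and `J` is a Gaussian integral
(`exists_integral_cexp_quadratic`). Applying `T_z` gives the formula for `Γ(S, z; w, ·)`, and `w =
0` gives the ground state.

Series. Let `M = Q⁻¹Q̄`. The raising operator `A_j^*` is multiplication by a multiple of `(Q⁻¹(x -
q))_j` minus `∑ M_{jk} A_k`, where the `A_k` are lowering operators (`raisingOp_add_loweringOp`).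
They annihilate `φ_0`, and the commutation relations give their action on every `φ_n`. At fixed `x`
the numbers `a_n = φ_n(x) c_n / n!` therefore satisfy `(n_j + 1) a_{n+e_j} = u_j a_n - 2 ∑ M_{jk}
a_{n-e_k}` with `u = 2ħ^(-1/2) Q⁻¹(x - q)`. This is the recursion of the Taylor coefficients of
`exp(uᵀw - wᵀMw)`. Summing over each degree reduces both the value and the absolute convergence to
the one-variable series of `exp(αt + βt²)`. -/

/-! ### Gaussians as Schwartz functions, and Gaussian integrals -/

theorem mulVec_dotProduct_eq {m n : Type*} [Fintype m] [Fintype n] {R : Type*} [CommSemiring R]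
    (M : Matrix m n R) (v : n → R) (u : m → R) : (M *ᵥ v) ⬝ᵥ u = v ⬝ᵥ (Mᵀ *ᵥ u) := by
  rw [dotProduct_comm, dotProduct_mulVec, mulVec_transpose, dotProduct_comm]

theorem norm_iteratedFDeriv_cexp_le (n : ℕ) (z : ℂ) :
    ‖iteratedFDeriv ℝ n Complex.exp z‖ ≤ ‖Complex.exp z‖ := by
  have h : ContDiffAt ℂ n Complex.exp z := Complex.contDiff_exp.contDiffAt
  rw [← h.restrictScalars_iteratedFDeriv (𝕜 := ℝ), Function.comp_apply,
    ContinuousMultilinearMap.norm_restrictScalars, norm_iteratedFDeriv_eq_norm_iteratedDeriv,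
    iteratedDeriv_eq_iterate, Complex.iter_deriv_exp]

/-- Combine `1 + r ≤ 2(1 + r²)` with `t^N / N! ≤ exp t` at `t = ε(1 + r²)`; the surplus `exp ε`
comes from the summand `1`. -/
theorem one_add_pow_mul_exp_neg_sq_le (N : ℕ) {ε r : ℝ} (hε : 0 < ε) (hr : 0 ≤ r) :
    (1 + r) ^ N * Real.exp (-(ε * r ^ 2)) ≤ 2 ^ N * N.factorial / ε ^ N * Real.exp ε := by
  have h1 : (1 + r) ^ N ≤ 2 ^ N * (1 + r ^ 2) ^ N := by
    rw [← mul_pow]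
    refine pow_le_pow_left₀ (by positivity) ?_ _
    nlinarith [sq_nonneg (r - 1)]
  have h2 := Real.pow_div_factorial_le_exp (ε * (1 + r ^ 2)) (by positivity) N
  have h3 : (1 + r ^ 2) ^ N ≤ N.factorial / ε ^ N * Real.exp (ε * (1 + r ^ 2)) := by
    rw [div_le_iff₀ (by positivity), mul_pow] at h2
    rw [div_mul_eq_mul_div, le_div_iff₀ (by positivity)]
    linarith
  calc (1 + r) ^ N * Real.exp (-(ε * r ^ 2))
      ≤ (2 ^ N * (N.factorial / ε ^ N * Real.exp (ε * (1 + r ^ 2))))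
          * Real.exp (-(ε * r ^ 2)) := by
        gcongr
        exact h1.trans (by gcongr)
    _ = 2 ^ N * N.factorial / ε ^ N
          * (Real.exp (ε * (1 + r ^ 2)) * Real.exp (-(ε * r ^ 2))) := by ring
    _ = _ := by rw [← Real.exp_add]; ring_nf

/-- The exponential of a function of temperate growth whose real part is at most
`C - ε ‖x‖²` is a Schwartz function. -/
theorem exists_schwartzMap_eq_cexp {E : Type*} [NormedAddCommGroup E] [NormedSpace ℝ E]
    {g : E → ℂ} (hg : g.HasTemperateGrowth) {ε C : ℝ} (hε : 0 < ε)
    (h : ∀ x, (g x).re ≤ C - ε * ‖x‖ ^ 2) :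
    ∃ f : 𝓢(E, ℂ), ∀ x, f x = Complex.exp (g x) := by
  refine ⟨⟨fun x => Complex.exp (g x), Complex.contDiff_exp.comp hg.1, fun k n => ?_⟩,
    fun x => rfl⟩
  obtain ⟨m, B, hB0, hB⟩ := hg.norm_iteratedFDeriv_le_uniform n
  -- The polynomial growth to be beaten: `k` from the Schwartz weight and `m * n` from the `n`-th
  -- power in the Faà di Bruno bound.
  set N := k + m * n
  refine ⟨n.factorial * (1 + B) ^ n * Real.exp C
    * (2 ^ N * N.factorial / ε ^ N * Real.exp ε), fun x => ?_⟩
  have hx : ‖iteratedFDeriv ℝ n (Complex.exp ∘ g) x‖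
      ≤ n.factorial * ‖Complex.exp (g x)‖ * ((1 + B) * (1 + ‖x‖) ^ m) ^ n := by
    refine norm_iteratedFDeriv_comp_le Complex.contDiff_exp hg.1 (by exact_mod_cast le_top)
      x (fun i _ => norm_iteratedFDeriv_cexp_le i _) fun i hi hin => ?_
    -- Enlarging `B` to `1 + B` makes the base at least `1`, so that its `i`-th power, `i ≥ 1`,
    -- dominates the bound on the `i`-th derivative of `g`.
    have h1 : 1 ≤ (1 + B) * (1 + ‖x‖) ^ m :=
      one_le_mul_of_one_le_of_one_le (by linarith) (one_le_pow₀ (by linarith [norm_nonneg x]))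
    refine le_trans ?_ (le_self_pow₀ h1 (by omega))
    exact (hB i hin x).trans (by gcongr; linarith)
  have he : ‖Complex.exp (g x)‖ ≤ Real.exp C * Real.exp (-(ε * ‖x‖ ^ 2)) := by
    rw [Complex.norm_exp, ← Real.exp_add]
    exact Real.exp_le_exp.mpr (by linarith [h x])
  have hk : ‖x‖ ^ k ≤ (1 + ‖x‖) ^ k := by gcongr; linarith
  calc ‖x‖ ^ k * ‖iteratedFDeriv ℝ n (Complex.exp ∘ g) x‖
      ≤ (1 + ‖x‖) ^ k * (n.factorial * (Real.exp C * Real.exp (-(ε * ‖x‖ ^ 2)))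
          * ((1 + B) * (1 + ‖x‖) ^ m) ^ n) := by
        gcongr
        exact hx.trans (by gcongr)
    _ = n.factorial * (1 + B) ^ n * Real.exp C
          * ((1 + ‖x‖) ^ N * Real.exp (-(ε * ‖x‖ ^ 2))) := by
        rw [mul_pow, ← pow_mul, pow_add]; ring
    _ ≤ _ := by
        refine mul_le_mul_of_nonneg_left ?_ (by positivity)
        exact one_add_pow_mul_exp_neg_sq_le N hε (norm_nonneg x)

/-- Write `Y = BᵀB`, diagonalize the symmetric matrix `B⁻ᵀXB⁻¹` by an orthogonal `O`, and take `K =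
B⁻¹O`. -/
theorem exists_simultaneous_diagonalization {Y X : Matrix (Fin d) (Fin d) ℝ} (hY : Y.PosDef)
    (hX : X.IsSymm) :
    ∃ (K : GL (Fin d) ℝ) (l : Fin d → ℝ), K.1ᵀ * Y * K.1 = 1 ∧ K.1ᵀ * X * K.1 = diagonal l := by
  obtain ⟨B, hB, rfl⟩ : ∃ B : Matrix (Fin d) (Fin d) ℝ, IsUnit B ∧ Y = Bᵀ * B := by
    open scoped MatrixOrder in
    obtain ⟨B, hB, h⟩ :=
      CStarAlgebra.isStrictlyPositive_iff_eq_star_mul_self.mp hY.isStrictlyPositive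
    exact ⟨B, hB, by rw [h, star_eq_conjTranspose, conjTranspose_eq_transpose_of_trivial]⟩
  have hBd := (Matrix.isUnit_iff_isUnit_det _).mp hB
  have hH : ((B⁻¹)ᵀ * X * B⁻¹).IsHermitian := by
    rw [Matrix.IsHermitian, conjTranspose_eq_transpose_of_trivial]
    simp [transpose_mul, hX.eq, Matrix.mul_assoc]
  set O := hH.eigenvectorUnitary
  have hO : (O.1)ᵀ * O.1 = 1 := by
    have := Unitary.coe_star_mul_self O
    rwa [star_eq_conjTranspose, conjTranspose_eq_transpose_of_trivial] at this
  have hOd : IsUnit O.1 := Units.isUnit (Unitary.toUnits O)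
  have hdiag : (O.1)ᵀ * ((B⁻¹)ᵀ * X * B⁻¹) * O.1 = diagonal hH.eigenvalues := by
    have := hH.conjStarAlgAut_star_eigenvectorUnitary
    rw [Unitary.conjStarAlgAut_star_apply, star_eq_conjTranspose,
      conjTranspose_eq_transpose_of_trivial] at this
    simpa using this
  obtain ⟨K, hK⟩ : IsUnit (B⁻¹ * O.1) :=
    (Matrix.isUnit_nonsing_inv_iff.mpr hB).mul hOd
  refine ⟨K, hH.eigenvalues, ?_, ?_⟩
  · rw [hK, transpose_mul, ← hO]
    calc (O.1)ᵀ * (B⁻¹)ᵀ * (Bᵀ * B) * (B⁻¹ * O.1)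
        = (O.1)ᵀ * ((B * B⁻¹)ᵀ * (B * B⁻¹)) * O.1 := by
          simp only [transpose_mul, Matrix.mul_assoc]
      _ = _ := by simp [Matrix.mul_nonsing_inv _ hBd]
  · rw [hK, transpose_mul, ← hdiag]
    simp only [Matrix.mul_assoc]

theorem integral_comp_linHomeo (K : GL (Fin d) ℝ) (f : Space d → ℂ) :
    ∫ x, f x = (|K.1.det| : ℝ) * ∫ x : Space d, f (WithLp.toLp 2 (K.1 *ᵥ x.ofLp)) := by
  have hK : 0 < |K.1.det| :=
    abs_pos.mpr ((Matrix.isUnit_iff_isUnit_det _).mp K.isUnit).ne_zero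
  have h : ∫ x, f x ∂((volume : Measure (Space d)).map (linHomeo K)) = ∫ x, f (linHomeo K x) :=
    integral_map_equiv (linHomeo K).toMeasurableEquiv f
  rw [map_linHomeo, integral_smul_measure, Real.sq_sqrt (abs_nonneg _),
    ENNReal.toReal_ofReal (by positivity)] at h
  change _ = ((|K.1.det| : ℝ) : ℂ) * ∫ x, f (linHomeo K x)
  rw [← h, Complex.real_smul, ← mul_assoc, ← Complex.ofReal_mul, mul_inv_cancel₀ hK.ne',
    Complex.ofReal_one, one_mul]

/-- The integral of a complex Gaussian. -/
theorem exists_integral_cexp_quadratic {A : Matrix (Fin d) (Fin d) ℂ} (hA : A.IsSymm)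
    (hpos : (A.map Complex.re).PosDef) :
    ∃ c : ℂ, c ^ 2 * A.det = (2 * Real.pi) ^ d ∧ ∀ b : Fin d → ℂ,
      ∫ x : Space d, Complex.exp (-(1 / 2) * (cvec x ⬝ᵥ (A *ᵥ cvec x)) + b ⬝ᵥ cvec x)
        = c * Complex.exp (1 / 2 * (b ⬝ᵥ (A⁻¹ *ᵥ b))) := by
  have hX : (A.map Complex.im).IsSymm := hA.map _
  -- A real congruence that diagonalizes `Re A` and `Im A` together turns `A` into `diag(1 + i l)`,
  -- so the substitution `x = K v` splits the integral into one-dimensional Gaussian integrals.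
  obtain ⟨K, l, h1, h2⟩ := exists_simultaneous_diagonalization hpos hX
  set Kc : Matrix (Fin d) (Fin d) ℂ := K.1.map Complex.ofReal
  have hKdet : Kc.det = K.1.det := by
    rw [← Complex.ofRealHom_eq_coe, RingHom.map_det]; rfl
  have hK0 : K.1.det ≠ 0 := ((Matrix.isUnit_iff_isUnit_det _).mp K.isUnit).ne_zero
  set β : Fin d → ℂ := fun i => 1 + Complex.I * l i
  have hβ : ∀ i, 0 < (β i / 2).re := fun i => by simp [β]
  have hβ0 : ∀ i, β i ≠ 0 := fun i h => by have := hβ i; simp [h] at this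
  have hAd : Kcᵀ * A * Kc = diagonal β := by
    have hA' : A = (A.map Complex.re).map Complex.ofReal
        + Complex.I • (A.map Complex.im).map Complex.ofReal := by
      ext i j
      simp [mul_comm Complex.I]
    have e1 := congrArg (fun M => M.map Complex.ofRealHom) h1
    have e2 := congrArg (fun M => M.map Complex.ofRealHom) h2
    simp only [Matrix.map_mul] at e1 e2
    rw [hA', Matrix.mul_add, Matrix.add_mul, Matrix.mul_smul, Matrix.smul_mul]
    refine (congrArg₂ (fun M N => M + Complex.I • N) e1 e2).trans ?_
    ext i j
    by_cases h : i = j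
    · subst h; simp [β]
    · simp [h]
  have hdet : (K.1.det : ℂ) ^ 2 * A.det = ∏ i, β i := by
    rw [← det_diagonal, ← hAd, det_mul, det_mul, det_transpose, hKdet]; ring
  have hAinv : A⁻¹ = Kc * diagonal (fun i => (β i)⁻¹) * Kcᵀ := by
    have hKu : IsUnit Kc.det := by rw [hKdet]; exact (Complex.ofReal_ne_zero.mpr hK0).isUnit
    have hKtu : IsUnit (Kcᵀ).det := by rwa [det_transpose]
    refine Matrix.inv_eq_left_inv ?_
    have h3 : Kcᵀ * A = diagonal β * Kc⁻¹ := by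
      rw [← hAd, Matrix.mul_nonsing_inv_cancel_right _ _ hKu]
    rw [Matrix.mul_assoc, h3, Matrix.mul_assoc, ← Matrix.mul_assoc (diagonal _),
      diagonal_mul_diagonal]
    simp [hβ0, Matrix.mul_nonsing_inv _ hKu]
  -- The Jacobian of `x = K v` times the one-dimensional constants; `β i / 2` appears because those
  -- integrals have exponent `-b t²` without the factor `1/2`.
  refine ⟨(|K.1.det| : ℝ) * ∏ i, (Real.pi / (β i / 2)) ^ (1 / 2 : ℂ), ?_, fun b => ?_⟩
  · rw [mul_pow, ← Complex.ofReal_pow, sq_abs, ← Finset.prod_pow, mul_right_comm,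
      Complex.ofReal_pow, hdet, ← Finset.prod_mul_distrib]
    rw [Finset.prod_congr rfl (g := fun _ => (2 * Real.pi : ℂ)) fun i _ => ?_]
    · simp
    · rw [← Complex.cpow_nat_mul]
      have := hβ0 i
      norm_num
      field_simp
  · rw [integral_comp_linHomeo K, mul_assoc]
    congr 1
    rw [← (PiLp.volume_preserving_toLp (Fin d)).integral_comp
      (MeasurableEquiv.toLp 2 _).measurableEmbedding]
    have hc : ∀ v : Fin d → ℝ, cvec (WithLp.toLp 2 (K.1 *ᵥ v)) = Kc *ᵥ (fun i => (v i : ℂ)) := by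
      intro v
      ext i
      simp [cvec, Kc, mulVec, dotProduct]
    have hint := GaussianFourier.integral_cexp_neg_sum_mul_add hβ (Kcᵀ *ᵥ b)
    refine Eq.trans ?_ (hint.trans ?_)
    · refine integral_congr_ae (ae_of_all _ fun v => ?_)
      simp only [hc]
      congr 2
      · rw [mulVec_dotProduct_eq, mulVec_mulVec, mulVec_mulVec, hAd,
          dotProduct, Finset.mul_sum, ← Finset.sum_neg_distrib]
        refine Finset.sum_congr rfl fun i _ => ?_
        rw [mulVec_diagonal]
        ring
      · rw [dotProduct_comm, mulVec_dotProduct_eq, dotProduct_comm, dotProduct]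
    · rw [Finset.prod_mul_distrib, ← Complex.exp_sum]
      congr 2
      rw [hAinv, ← mulVec_mulVec, ← mulVec_mulVec, dotProduct_comm, mulVec_dotProduct_eq,
        dotProduct, Finset.mul_sum]
      refine Finset.sum_congr rfl fun i _ => ?_
      rw [mulVec_diagonal]
      have := hβ0 i
      field_simp
      ring

/-! ### Normalized Lagrangian frames -/

theorem cvec_add (x y : Space d) : cvec (x + y) = cvec x + cvec y := by
  ext i; simp [cvec]

theorem cvec_smul (a : ℝ) (x : Space d) : cvec (a • x) = (a : ℂ) • cvec x := by
  ext i; simp [cvec]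

theorem star_cvec (x : Space d) : star (cvec x) = cvec x := by
  ext i; simp [cvec]

theorem cvec_dotProduct_cvec (x y : Space d) : cvec x ⬝ᵥ cvec y = (inner ℝ x y : ℝ) := by
  simp [cvec, dotProduct, PiLp.inner_apply, mul_comm]

theorem hasTemperateGrowth_cvec_apply (i : Fin d) :
    Function.HasTemperateGrowth (fun x : Space d => cvec x i) :=
  (Complex.ofRealCLM.comp (EuclideanSpace.proj i : Space d →L[ℝ] ℝ)).hasTemperateGrowth

/-- Normalized Lagrangian frames: pairs of matrices with `Qᵀ P = Pᵀ Q` and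
`Q^* P - P^* Q = 2i`. -/
structure IsFrame (Q P : Matrix (Fin d) (Fin d) ℂ) : Prop where
  symm : Qᵀ * P = Pᵀ * Q
  normalized : Qᴴ * P - Pᴴ * Q = (2 * Complex.I) • 1

namespace IsFrame

variable {Q P : Matrix (Fin d) (Fin d) ℂ}

/-- Both frame relations are values of the symplectic form `J` on the stacked matrix, one bilinear
and one sesquilinear; in this shape their symplectic invariance is visible. -/
theorem iff_fromRows : IsFrame Q P ↔
    (fromRows Q P)ᵀ * J (Fin d) ℂ * fromRows Q P = 0 ∧
    (fromRows Q P)ᴴ * J (Fin d) ℂ * fromRows Q P = -((2 * Complex.I) • 1) := by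
  have hJ : J (Fin d) ℂ * fromRows Q P = fromRows (-P) Q := by
    rw [J, fromBlocks_mul_fromRows]
    simp
  rw [Matrix.mul_assoc, Matrix.mul_assoc, hJ, transpose_fromRows,
    conjTranspose_fromRows_eq_fromCols_conjTranspose, fromCols_mul_fromRows, fromCols_mul_fromRows]
  constructor
  · rintro ⟨h1, h2⟩
    exact ⟨by rw [Matrix.mul_neg, h1]; simp, by rw [← h2, Matrix.mul_neg]; abel⟩
  · rintro ⟨h1, h2⟩
    refine ⟨?_, ?_⟩
    · rw [Matrix.mul_neg, neg_add_eq_zero] at h1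
      exact h1
    · rw [← neg_inj, ← h2, Matrix.mul_neg]; abel

/-- Since `S` is real, `S^* = Sᵀ`, so the single identity `SᵀJS = J` preserves both forms. -/
theorem of_symplectic {Q' P' : Matrix (Fin d) (Fin d) ℂ} (h : IsFrame Q P)
    (S : symplecticGroup (Fin d) ℝ)
    (hS : fromRows Q' P' = S.1.map Complex.ofReal * fromRows Q P) : IsFrame Q' P' := by
  have hSt : (S.1.map Complex.ofReal)ᵀ * J (Fin d) ℂ * S.1.map Complex.ofReal = J (Fin d) ℂ := by
    have := congrArg (fun M => M.map Complex.ofRealHom) (SymplecticGroup.mem_iff'.mp S.2)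
    simp only [Matrix.map_mul, map_J] at this
    exact this
  have hSh : (S.1.map Complex.ofReal)ᴴ = (S.1.map Complex.ofReal)ᵀ := by
    ext i j; simp
  rw [iff_fromRows] at h ⊢
  rw [hS, transpose_mul, conjTranspose_mul, hSh]
  have key : ∀ N : Matrix (Fin d) (Fin d ⊕ Fin d) ℂ,
      N * (S.1.map Complex.ofReal)ᵀ * J (Fin d) ℂ * (S.1.map Complex.ofReal * fromRows Q P)
        = N * J (Fin d) ℂ * fromRows Q P := fun N => by
    conv_rhs => rw [← hSt]
    simp only [Matrix.mul_assoc]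
  rw [key, key]
  exact h

/-- If `Qv = 0`, evaluating `Q^*P - P^*Q = 2i` on `v` gives `0 = 2i|v|²`. -/
theorem isUnit_det (h : IsFrame Q P) : IsUnit Q.det := by
  rw [isUnit_iff_ne_zero]
  intro h0
  obtain ⟨v, hv, hQv⟩ := exists_mulVec_eq_zero_iff.mpr h0
  have h1 := congrArg (fun M => star v ⬝ᵥ (M *ᵥ v)) h.normalized
  simp only [sub_mulVec, ← mulVec_mulVec, hQv, mulVec_zero, sub_zero, smul_mulVec, one_mulVec,
    dotProduct_smul] at h1
  rw [dotProduct_mulVec, vecMul_conjTranspose, star_star, hQv] at h1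
  have h2 : star v ⬝ᵥ v = 0 := by simpa using h1
  open scoped ComplexOrder in
  exact hv (dotProduct_star_self_eq_zero.mp h2)

theorem mul_inv_isSymm (h : IsFrame Q P) : (P * Q⁻¹).IsSymm := by
  have hQ := h.isUnit_det
  have hQt : IsUnit (Qᵀ).det := by rwa [det_transpose]
  rw [IsSymm, transpose_mul, transpose_nonsing_inv]
  have : Pᵀ = Qᵀ * P * Q⁻¹ := by rw [h.symm, Matrix.mul_nonsing_inv_cancel_right _ _ hQ]
  rw [this, Matrix.mul_assoc, Matrix.nonsing_inv_mul_cancel_left _ _ hQt]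

theorem map_conj_eq (Q : Matrix (Fin d) (Fin d) ℂ) : Q.map (starRingEnd ℂ) = (Qᵀ)ᴴ := by
  ext i j; simp

/-- `Pᵀ Q̄ - Qᵀ P̄ = 2i` -/
theorem normalized_conj (h : IsFrame Q P) :
    Pᵀ * Q.map (starRingEnd ℂ) - Qᵀ * P.map (starRingEnd ℂ) = (2 * Complex.I) • 1 := by
  have := congrArg transpose h.normalized
  rw [transpose_sub, transpose_mul, transpose_mul, transpose_smul, transpose_one] at this
  exact this

/-- The matrix `B = PQ⁻¹` is symmetric, hence so is `B - B^* = 2i (QQ^*)⁻¹`. Thus `QQ^* = Q̄Qᵀ`,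
which rearranges to `Q⁻¹Q̄ = Q^*Q⁻ᵀ`. -/
theorem inv_mul_conj_isSymm (h : IsFrame Q P) : (Q⁻¹ * Q.map (starRingEnd ℂ)).IsSymm := by
  have hQ := h.isUnit_det
  have hQt : IsUnit (Qᵀ).det := by rwa [det_transpose]
  have hQc : IsUnit (Q.map (starRingEnd ℂ)).det := by
    rw [map_conj_eq, det_conjTranspose, det_transpose]; exact hQ.star
  have hQh : IsUnit (Qᴴ).det := by rw [det_conjTranspose]; exact hQ.star
  have h1 : P * Q⁻¹ - (P * Q⁻¹)ᴴ = (2 * Complex.I) • ((Qᴴ)⁻¹ * Q⁻¹) := by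
    calc P * Q⁻¹ - (P * Q⁻¹)ᴴ = (Qᴴ)⁻¹ * (Qᴴ * P - Pᴴ * Q) * Q⁻¹ := by
          rw [Matrix.mul_sub, Matrix.sub_mul, Matrix.nonsing_inv_mul_cancel_left _ _ hQh,
            conjTranspose_mul, conjTranspose_nonsing_inv, Matrix.mul_assoc (Qᴴ)⁻¹ (Pᴴ * Q),
            Matrix.mul_nonsing_inv_cancel_right _ _ hQ]
      _ = _ := by rw [h.normalized]; simp
  have h2 : (Qᴴ)⁻¹ * Q⁻¹ = (Qᵀ)⁻¹ * (Q.map (starRingEnd ℂ))⁻¹ := by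
    have h3 := congrArg transpose h1
    have h4 : ((P * Q⁻¹)ᴴ)ᵀ = (P * Q⁻¹)ᴴ := by
      change ((P * Q⁻¹)ᵀ)ᴴ = _
      rw [h.mul_inv_isSymm.eq]
    rw [transpose_sub, h4, h.mul_inv_isSymm.eq, h1, transpose_smul] at h3
    have h5 := smul_right_injective _ (by simp : (2 * Complex.I) ≠ 0) h3
    rw [h5, transpose_mul, transpose_nonsing_inv, transpose_nonsing_inv]
    rfl
  rw [IsSymm, transpose_mul, transpose_nonsing_inv]
  change Qᴴ * (Qᵀ)⁻¹ = _
  calc Qᴴ * (Qᵀ)⁻¹ = Qᴴ * ((Qᵀ)⁻¹ * (Q.map (starRingEnd ℂ))⁻¹) * Q.map (starRingEnd ℂ) := by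
        rw [Matrix.mul_assoc, Matrix.nonsing_inv_mul_cancel_right _ _ hQc]
    _ = _ := by rw [← h2, Matrix.mul_nonsing_inv_cancel_left _ _ hQh]

end IsFrame

/-- Put `v = Q⁻¹x`. Because `x` is real, the form equals `v^*Q^*Pv`, and subtracting its conjugate
leaves `v^*(Q^*P - P^*Q)v = 2i|v|²`. This identity is the source of the Gaussian decay. -/
theorem im_cvec_dotProduct {Q P : Matrix (Fin d) (Fin d) ℂ} (h : IsFrame Q P) (x : Space d) :
    (cvec x ⬝ᵥ ((P * Q⁻¹) *ᵥ cvec x)).im = ∑ i, ‖(Q⁻¹ *ᵥ cvec x) i‖ ^ 2 := by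
  set v := Q⁻¹ *ᵥ cvec x with hv
  have hQv : Q *ᵥ v = cvec x := by
    rw [hv, mulVec_mulVec, Matrix.mul_nonsing_inv _ h.isUnit_det, one_mulVec]
  set a := cvec x ⬝ᵥ ((P * Q⁻¹) *ᵥ cvec x) with ha
  have h1 : a = star v ⬝ᵥ ((Qᴴ * P) *ᵥ v) := by
    rw [ha, ← mulVec_mulVec, ← hv, ← star_cvec x, ← hQv, star_mulVec, ← dotProduct_mulVec,
      mulVec_mulVec]
  have h2 : star a = star v ⬝ᵥ ((Pᴴ * Q) *ᵥ v) := by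
    rw [h1, ← star_dotProduct, star_mulVec, conjTranspose_mul, conjTranspose_conjTranspose,
      ← dotProduct_mulVec]
  have h3 := congrArg (fun M => star v ⬝ᵥ (M *ᵥ v)) h.normalized
  simp only [sub_mulVec, dotProduct_sub, ← h1, ← h2, smul_mulVec, one_mulVec,
    dotProduct_smul] at h3
  have h4 : star v ⬝ᵥ v = ((∑ i, ‖v i‖ ^ 2 : ℝ) : ℂ) := by
    simp [dotProduct, Complex.conj_mul']
  rw [h4] at h3
  have h5 := congrArg Complex.im h3
  rw [smul_eq_mul, mul_assoc, ← Complex.ofReal_ofNat, Complex.im_ofReal_mul, Complex.I_mul_im,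
    Complex.ofReal_re, Complex.sub_im, Complex.star_def, Complex.conj_im] at h5
  linarith

theorem posDef_map_im {Q P : Matrix (Fin d) (Fin d) ℂ} (h : IsFrame Q P) :
    ((P * Q⁻¹).map Complex.im).PosDef := by
  have hsymm : ((P * Q⁻¹).map Complex.im).IsSymm := h.mul_inv_isSymm.map _
  refine .of_dotProduct_mulVec_pos ?_ fun x hx => ?_
  · rw [IsHermitian, conjTranspose_eq_transpose_of_trivial]; exact hsymm
  · have h1 := im_cvec_dotProduct h (WithLp.toLp 2 x)
    have h2 : star x ⬝ᵥ ((P * Q⁻¹).map Complex.im *ᵥ x)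
        = (cvec (WithLp.toLp 2 x) ⬝ᵥ ((P * Q⁻¹) *ᵥ cvec (WithLp.toLp 2 x))).im := by
      simp [cvec, dotProduct, mulVec]
    rw [h2, h1]
    refine lt_of_le_of_ne (by positivity) fun h0 => hx ?_
    have h3 : Q⁻¹ *ᵥ cvec (WithLp.toLp 2 x) = 0 := by
      ext i
      have := (Finset.sum_eq_zero_iff_of_nonneg fun i _ => by positivity).mp h0.symm i
        (Finset.mem_univ i)
      simpa using this
    have h4 := congrArg (Q *ᵥ ·) h3
    simp only [mulVec_mulVec, Matrix.mul_nonsing_inv _ h.isUnit_det, one_mulVec,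
      mulVec_zero] at h4
    ext i
    simpa [cvec] using congrFun h4 i

/-- The quadratic part of the exponent has real part `-|Q⁻¹x|²/(2ħ)`, and `|x| ≤ ‖Q‖ |Q⁻¹x|` bounds
it by `-ε|x|²`. The linear term costs at most half of this decay, by Young's inequality. -/
theorem exists_schwartzMap_quadratic {ħ : ℝ} (hħ : 0 < ħ) {Q P : Matrix (Fin d) (Fin d) ℂ}
    (h : IsFrame Q P) (c : Fin d → ℂ) (k : ℂ) :
    ∃ f : 𝓢(Space d, ℂ), ∀ x, f x = Complex.exp
      (Complex.I / ħ * (1 / 2 * (cvec x ⬝ᵥ ((P * Q⁻¹) *ᵥ cvec x))) + c ⬝ᵥ cvec x + k) := by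
  have hgrowth : Function.HasTemperateGrowth fun x : Space d =>
      Complex.I / ħ * (1 / 2 * (cvec x ⬝ᵥ ((P * Q⁻¹) *ᵥ cvec x))) + c ⬝ᵥ cvec x + k := by
    have := hasTemperateGrowth_cvec_apply (d := d)
    simp only [dotProduct, mulVec]
    fun_prop
  obtain ⟨ε, hε, hquad⟩ : ∃ ε > 0, ∀ x : Space d,
      -- The operator norm `‖T‖` of `Q` vanishes when `d = 0`; the `+ 1` in the witness keeps its
      -- denominator positive.
      ε * ‖x‖ ^ 2 ≤ 1 / (2 * ħ) * ∑ i, ‖(Q⁻¹ *ᵥ cvec x) i‖ ^ 2 := by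
    set T := Matrix.toEuclideanCLM (n := Fin d) (𝕜 := ℂ) Q
    refine ⟨1 / (2 * ħ) / (‖T‖ ^ 2 + 1), by positivity, fun x => ?_⟩
    have h1 : T (WithLp.toLp 2 (Q⁻¹ *ᵥ cvec x)) = WithLp.toLp 2 (cvec x) := by
      simp [T, mulVec_mulVec, Matrix.mul_nonsing_inv _ h.isUnit_det]
    have h2 := T.le_opNorm (WithLp.toLp 2 (Q⁻¹ *ᵥ cvec x))
    have h3 : ‖x‖ ^ 2 ≤ ‖T‖ ^ 2 * ∑ i, ‖(Q⁻¹ *ᵥ cvec x) i‖ ^ 2 := by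
      rw [h1] at h2
      have h4 := pow_le_pow_left₀ (norm_nonneg _) h2 2
      rw [mul_pow, EuclideanSpace.norm_sq_eq, EuclideanSpace.norm_sq_eq] at h4
      rw [EuclideanSpace.norm_sq_eq]
      simpa [cvec] using h4
    have h5 : 0 ≤ ∑ i, ‖(Q⁻¹ *ᵥ cvec x) i‖ ^ 2 := by positivity
    rw [div_mul_eq_mul_div, div_le_iff₀ (by positivity), mul_assoc]
    refine mul_le_mul_of_nonneg_left ?_ (by positivity)
    linarith
  have hlin : ∀ x : Space d, (c ⬝ᵥ cvec x).re ≤ (∑ i, ‖c i‖) * ‖x‖ := by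
    intro x
    refine (Complex.re_le_norm _).trans ?_
    rw [dotProduct, Finset.sum_mul]
    refine norm_sum_le_of_le _ fun i _ => ?_
    rw [norm_mul]
    gcongr
    simpa [cvec] using PiLp.norm_apply_le x i
  refine exists_schwartzMap_eq_cexp hgrowth (half_pos hε) (C := (∑ i, ‖c i‖) ^ 2 / (2 * ε) + k.re)
    fun x => ?_
  have h1 : (Complex.I / ħ * (1 / 2 * (cvec x ⬝ᵥ ((P * Q⁻¹) *ᵥ cvec x)))).re
      = -(1 / (2 * ħ) * ∑ i, ‖(Q⁻¹ *ᵥ cvec x) i‖ ^ 2) := by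
    rw [← im_cvec_dotProduct h x, show Complex.I / ħ * (1 / 2 * (cvec x ⬝ᵥ ((P * Q⁻¹) *ᵥ cvec x)))
      = ((1 / (2 * ħ) : ℝ) : ℂ) * (Complex.I * (cvec x ⬝ᵥ ((P * Q⁻¹) *ᵥ cvec x))) by
        push_cast; field_simp, Complex.re_ofReal_mul, Complex.I_mul_re]
    ring
  rw [Complex.add_re, Complex.add_re, h1]
  have h2 := hquad x
  have h3 := hlin x
  have h4 : (∑ i, ‖c i‖) * ‖x‖ ≤ (∑ i, ‖c i‖) ^ 2 / (2 * ε) + ε / 2 * ‖x‖ ^ 2 := by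
    have : 0 ≤ ((∑ i, ‖c i‖) - ε * ‖x‖) ^ 2 / (2 * ε) := by positivity
    have e : ((∑ i, ‖c i‖) - ε * ‖x‖) ^ 2 / (2 * ε)
      = (∑ i, ‖c i‖) ^ 2 / (2 * ε) + ε / 2 * ‖x‖ ^ 2 - (∑ i, ‖c i‖) * ‖x‖ := by
      field_simp; ring
    linarith
  linarith

/-! ### Metaplectic operators acting on Gaussian generating functions -/

/-- The Gaussian generating function attached to the frame `(Q, P)`, without the factor
`(det Q)^(-1/2)`. -/
def gaussianGen (ħ : ℝ) (Q P : Matrix (Fin d) (Fin d) ℂ) (w : Fin d → ℂ) (x : Space d) : ℂ :=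
  ((((Real.pi * ħ) ^ ((d : ℝ) / 4))⁻¹ : ℝ) : ℂ) *
    Complex.exp (Complex.I / ħ * (1 / 2 * (cvec x ⬝ᵥ ((P * Q⁻¹) *ᵥ cvec x)))
      + 2 / (√ħ : ℂ) * (w ⬝ᵥ (Q⁻¹ *ᵥ cvec x))
      - w ⬝ᵥ ((Q⁻¹ * Q.map (starRingEnd ℂ)) *ᵥ w))

theorem exists_schwartzMap_gaussianGen {ħ : ℝ} (hħ : 0 < ħ) {Q P : Matrix (Fin d) (Fin d) ℂ}
    (h : IsFrame Q P) (w : Fin d → ℂ) : ∃ f : 𝓢(Space d, ℂ), ∀ x, f x = gaussianGen ħ Q P w x := by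
  obtain ⟨f, hf⟩ := exists_schwartzMap_quadratic hħ h ((2 / (√ħ : ℂ)) • ((Q⁻¹)ᵀ *ᵥ w))
    (-(w ⬝ᵥ ((Q⁻¹ * Q.map (starRingEnd ℂ)) *ᵥ w)))
  refine ⟨((((Real.pi * ħ) ^ ((d : ℝ) / 4))⁻¹ : ℝ) : ℂ) • f, fun x => ?_⟩
  rw [_root_.smul_apply, hf, gaussianGen, smul_eq_mul, smul_dotProduct, smul_eq_mul,
    mulVec_dotProduct_eq, transpose_transpose, ← sub_eq_add_neg]

/-- `U` maps the Gaussian generating functions of every frame to those of its image under `S`, up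
to a square root of the quotient of the determinants. -/
def MapsGaussians (ħ : ℝ) (U : UnitaryOp d) (S : symplecticGroup (Fin d) ℝ) : Prop :=
  ∀ Q P Q' P' : Matrix (Fin d) (Fin d) ℂ, IsFrame Q P →
    fromRows Q' P' = S.1.map Complex.ofReal * fromRows Q P →
    ∃ κ : ℂ, κ ^ 2 * Q'.det = Q.det ∧ ∀ (w : Fin d → ℂ) (f f' : 𝓢(Space d, ℂ)),
      (∀ x, f x = gaussianGen ħ Q P w x) → (∀ x, f' x = gaussianGen ħ Q' P' w x) →
      U (f.toLp 2 volume) = κ • f'.toLp 2 volume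

namespace MapsGaussians

variable {ħ : ℝ} {U V : UnitaryOp d} {S T : symplecticGroup (Fin d) ℝ}

theorem one : MapsGaussians ħ (1 : UnitaryOp d) 1 := by
  intro Q P Q' P' h hS
  have h1 : fromRows Q' P' = fromRows Q P := by
    rw [hS]
    simp [Matrix.map_one]
  obtain ⟨rfl, rfl⟩ := fromRows_inj h1
  refine ⟨1, by simp, fun w f f' hf hf' => ?_⟩
  have : f = f' := by ext x; rw [hf, hf']
  rw [this, one_smul]
  rfl

theorem mul (hħ : 0 < ħ) (hU : MapsGaussians ħ U S) (hV : MapsGaussians ħ V T) :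
    MapsGaussians ħ (U * V) (S * T) := by
  intro Q P Q' P' h hS
  obtain ⟨Q₁, P₁, h₁⟩ : ∃ Q₁ P₁, fromRows Q₁ P₁ = T.1.map Complex.ofReal * fromRows Q P :=
    ⟨_, _, fromRows_toRows _⟩
  have h₂ : fromRows Q' P' = S.1.map Complex.ofReal * fromRows Q₁ P₁ := by
    rw [hS, h₁, ← Matrix.mul_assoc]
    congr 1
    exact Matrix.map_mul (f := Complex.ofRealHom)
  have hf₁ := h.of_symplectic T h₁
  obtain ⟨κ, hκ, hVf⟩ := hV Q P Q₁ P₁ h h₁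
  obtain ⟨μ, hμ, hUf⟩ := hU Q₁ P₁ Q' P' hf₁ h₂
  refine ⟨κ * μ, by rw [mul_pow, mul_assoc, hμ, hκ], fun w f f' hf hf' => ?_⟩
  obtain ⟨g, hg⟩ := exists_schwartzMap_gaussianGen hħ hf₁ w
  change U (V _) = _
  rw [hVf w f g hf hg, map_smul, hUf w g f' hg hf', smul_smul]

theorem inv (hU : MapsGaussians ħ U S) : MapsGaussians ħ U⁻¹ S⁻¹ := by
  intro Q P Q' P' h hS
  have h' := h.of_symplectic _ hS
  have h₁ : fromRows Q P = S.1.map Complex.ofReal * fromRows Q' P' := by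
    have : S.1.map Complex.ofReal * (S⁻¹).1.map Complex.ofReal = 1 := by
      refine (Matrix.map_mul (f := Complex.ofRealHom)).symm.trans ?_
      have : S.1 * (S⁻¹).1 = 1 := congrArg Subtype.val (mul_inv_cancel S)
      rw [this]
      simp
    rw [hS, ← Matrix.mul_assoc, this, Matrix.one_mul]
  obtain ⟨κ, hκ, hUf⟩ := hU Q' P' Q P h' h₁
  have hκ0 : κ ≠ 0 := by
    rintro rfl
    exact h'.isUnit_det.ne_zero (by rw [← hκ]; simp)
  refine ⟨κ⁻¹, by rw [← hκ]; field_simp, fun w f f' hf hf' => ?_⟩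
  change U.symm _ = _
  rw [LinearIsometryEquiv.symm_apply_eq, map_smul, hUf w f' f hf' hf, smul_smul,
    inv_mul_cancel₀ hκ0, one_smul]

end MapsGaussians

/-- Here `(Q, P) ↦ (Q, P + RQ)`, so `PQ⁻¹` becomes `PQ⁻¹ + R`, which is exactly the phase `V_R`,
while `Q⁻¹Q̄` is untouched; `κ = 1`. -/
theorem mapsGaussians_opV (ħ : ℝ) {S : symplecticGroup (Fin d) ℝ} {R : Matrix (Fin d) (Fin d) ℝ}
    (hS : S.1 = fromBlocks 1 0 R 1) : MapsGaussians ħ (opV ħ R) S := by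
  intro Q P Q' P' h hSQ
  rw [hS, fromBlocks_map, fromBlocks_mul_fromRows] at hSQ
  obtain ⟨rfl, rfl⟩ := fromRows_inj hSQ
  refine ⟨1, by simp [Matrix.map_one], fun w f f' hf hf' => ?_⟩
  rw [one_smul]
  apply Lp.ext
  filter_upwards [coeFn_opV ħ R (f.toLp 2), f.coeFn_toLp 2 volume, f'.coeFn_toLp 2 volume]
    with x h1 h2 h3
  rw [h1, h2, h3, hf, hf', gaussianGen, gaussianGen, mul_left_comm, ← Complex.exp_add]
  congr 2
  have hR : ((x.ofLp ⬝ᵥ (R *ᵥ x.ofLp) : ℝ) : ℂ)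
      = cvec x ⬝ᵥ (R.map Complex.ofReal *ᵥ cvec x) := by
    simp [cvec, dotProduct, mulVec]
  simp only [Matrix.map_one _ Complex.ofReal_zero Complex.ofReal_one,
    Matrix.map_zero _ Complex.ofReal_zero, Matrix.one_mul, Matrix.zero_mul, add_zero]
  rw [Matrix.add_mul, Matrix.mul_nonsing_inv_cancel_right _ _ h.isUnit_det, add_mulVec,
    dotProduct_add, ← hR]
  push_cast
  ring

/-- Here `(Q, P) ↦ (L⁻¹Q, LᵀP)`; `L` is real, so it cancels in `Q⁻¹Q̄`. The parity condition on `m`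
is what makes the square of `i^m √|det L|` equal to `det L` with its sign. -/
theorem mapsGaussians_opM (ħ : ℝ) {S : symplecticGroup (Fin d) ℝ} {L : GL (Fin d) ℝ} {m : ℤ}
    (hm : Even m ↔ 0 < L.1.det) (hS : S.1 = fromBlocks L⁻¹.1 0 0 L.1ᵀ) :
    MapsGaussians ħ (opM L m) S := by
  intro Q P Q' P' h hSQ
  rw [hS, fromBlocks_map, fromBlocks_mul_fromRows] at hSQ
  obtain ⟨rfl, rfl⟩ := fromRows_inj hSQ
  simp only [Matrix.map_zero _ Complex.ofReal_zero, Matrix.zero_mul, add_zero, zero_add]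
  set Lc := L.1.map Complex.ofReal
  set Li := L⁻¹.1.map Complex.ofReal
  have hLi : Lc * Li = 1 := by
    refine (Matrix.map_mul (f := Complex.ofRealHom)).symm.trans ?_
    rw [← Units.val_mul]
    simp
  have hLdet : Lc.det = L.1.det := by
    rw [← Complex.ofRealHom_eq_coe, RingHom.map_det]; rfl
  have hLiinv : Li⁻¹ = Lc := Matrix.inv_eq_left_inv hLi
  have hQinv : (Li * Q)⁻¹ = Q⁻¹ * Lc := by rw [Matrix.mul_inv_rev, hLiinv]
  have hm2 : (Complex.I ^ m * (√|L.1.det| : ℝ)) ^ 2 = L.1.det := by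
    rw [mul_pow, ← Complex.ofReal_pow, Real.sq_sqrt (abs_nonneg _), ← zpow_natCast (_ ^ m),
      ← _root_.zpow_mul, mul_comm m, _root_.zpow_mul]
    have hL0 : L.1.det ≠ 0 := ((Matrix.isUnit_iff_isUnit_det _).mp L.isUnit).ne_zero
    rcases lt_or_gt_of_ne hL0 with hL | hL
    · have : Odd m := by
        rw [← Int.not_even_iff_odd, hm]; exact not_lt.mpr hL.le
      simp [this.neg_one_zpow, abs_of_neg hL]
    · simp [(hm.mpr hL).neg_one_zpow, abs_of_pos hL]
  refine ⟨Complex.I ^ m * (√|L.1.det| : ℝ), ?_, fun w f f' hf hf' => ?_⟩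
  · rw [hm2, det_mul, ← hLdet, ← mul_assoc, ← det_mul, hLi, det_one, one_mul]
  · apply Lp.ext
    filter_upwards [coeFn_opM L m (f.toLp 2),
      (quasiMeasurePreserving_of_map _ (map_linHomeo L)).ae (f.coeFn_toLp 2 volume),
      f'.coeFn_toLp 2 volume, Lp.coeFn_smul (Complex.I ^ m * (√|L.1.det| : ℝ) : ℂ) (f'.toLp 2)]
      with x h1 h2 h3 h4
    rw [h1, h4, Pi.smul_apply, smul_eq_mul, h3]
    refine congrArg _ (h2.trans ?_)
    have hc : cvec (linHomeo L x) = Lc *ᵥ cvec x := by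
      change cvec (WithLp.toLp 2 (L.1 *ᵥ x.ofLp)) = _
      ext i
      simp [cvec, Lc, mulVec, dotProduct]
    rw [hf, hf', gaussianGen, gaussianGen, hc, hQinv, mulVec_dotProduct_eq, mulVec_mulVec,
      mulVec_mulVec, mulVec_mulVec]
    have e1 : (Li * Q).map (starRingEnd ℂ) = Li * Q.map (starRingEnd ℂ) := by
      rw [Matrix.map_mul]
      congr 1
      ext i j
      simp [Li]
    have e2 : Q⁻¹ * Lc * (Li * Q.map (starRingEnd ℂ)) = Q⁻¹ * Q.map (starRingEnd ℂ) := by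
      rw [Matrix.mul_assoc, ← Matrix.mul_assoc Lc, hLi, Matrix.one_mul]
    rw [e1, e2]
    have e3 : L.1ᵀ.map Complex.ofReal * P * (Q⁻¹ * Lc) = Lcᵀ * (P * Q⁻¹) * Lc := by
      simp only [Matrix.mul_assoc]; rfl
    rw [e3]

/-- This is the image of the frame under `J`; it makes `isUnit_det` applicable to `P`. -/
theorem IsFrame.rotate {Q P : Matrix (Fin d) (Fin d) ℂ} (h : IsFrame Q P) : IsFrame P (-Q) where
  symm := by rw [Matrix.mul_neg, transpose_neg, Matrix.neg_mul, h.symm]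
  normalized := by
    rw [← h.normalized, Matrix.mul_neg, conjTranspose_neg, Matrix.neg_mul]; abel

/-- Multiply `QᵀP̄ = PᵀQ̄ - 2i` by `P⁻¹Q⁻ᵀ` and use the symmetry of `PQ⁻¹`. The correction is the
term quadratic in `w` that the Fourier transform of the Gaussian produces. -/
theorem IsFrame.inv_mul_conj_sub {Q P : Matrix (Fin d) (Fin d) ℂ} (h : IsFrame Q P) :
    P⁻¹ * P.map (starRingEnd ℂ)
      = Q⁻¹ * Q.map (starRingEnd ℂ) - (2 * Complex.I) • (P⁻¹ * (Q⁻¹)ᵀ) := by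
  have hQ := h.isUnit_det
  have hP := h.rotate.isUnit_det
  have hQt : IsUnit (Qᵀ).det := by rwa [det_transpose]
  have h1 : Qᵀ * P.map (starRingEnd ℂ)
      = Pᵀ * Q.map (starRingEnd ℂ) - (2 * Complex.I) • 1 := by
    rw [← h.normalized_conj]; abel
  have h2 : (Q⁻¹)ᵀ * Pᵀ = P * Q⁻¹ := by
    rw [← transpose_mul]; exact h.mul_inv_isSymm
  have h3 : P.map (starRingEnd ℂ) = (Q⁻¹)ᵀ * (Qᵀ * P.map (starRingEnd ℂ)) := by
    rw [transpose_nonsing_inv, Matrix.nonsing_inv_mul_cancel_left _ _ hQt]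
  rw [h3, h1, Matrix.mul_sub, ← Matrix.mul_assoc, h2, Matrix.mul_sub, Matrix.mul_assoc P,
    Matrix.nonsing_inv_mul_cancel_left _ _ hP, Matrix.mul_smul, Matrix.mul_one, Matrix.mul_smul]

theorem mapsGaussians_opJ {ħ : ℝ} (hħ : 0 < ħ) {S : symplecticGroup (Fin d) ℝ}
    (hS : S.1 = fromBlocks 0 1 (-1) 0) : MapsGaussians ħ (opJ hħ) S := by
  intro Q P Q' P' h hSQ
  have hSQ' : fromRows Q' P' = fromRows P (-Q) := by
    rw [hSQ, hS, fromBlocks_map, fromBlocks_mul_fromRows]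
    simp [Matrix.map_neg, Matrix.map_one]
  -- From here on the original `P` is called `Q'`, and `P'` has become `-Q`.
  obtain ⟨rfl, rfl⟩ := fromRows_inj hSQ'
  have hQ := h.isUnit_det
  have hP := h.rotate.isUnit_det
  have hħ0 : (ħ : ℂ) ≠ 0 := by exact_mod_cast hħ.ne'
  set A : Matrix (Fin d) (Fin d) ℂ := (-(Complex.I / ħ)) • (Q' * Q⁻¹)
  have hA : A.IsSymm := h.mul_inv_isSymm.smul _
  have hAre : A.map Complex.re = (1 / ħ) • (Q' * Q⁻¹).map Complex.im := by
    ext i j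
    simp only [A, map_apply, Matrix.smul_apply, smul_eq_mul]
    rw [show -(Complex.I / ħ) * (Q' * Q⁻¹) i j
      = ((1 / ħ : ℝ) : ℂ) * (-(Complex.I * (Q' * Q⁻¹) i j)) by push_cast; field_simp,
      Complex.re_ofReal_mul, Complex.neg_re, Complex.I_mul_re, neg_neg]
  have hApos : (A.map Complex.re).PosDef := by
    rw [hAre]; exact (posDef_map_im h).smul (by positivity)
  have hAinv : A⁻¹ = (Complex.I * ħ) • (Q * Q'⁻¹) := by
    refine Matrix.inv_eq_left_inv ?_
    simp only [A]
    rw [Matrix.smul_mul, Matrix.mul_smul, smul_smul, Matrix.mul_assoc,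
      Matrix.nonsing_inv_mul_cancel_left _ _ hP, Matrix.mul_nonsing_inv _ hQ]
    have : Complex.I * ħ * -(Complex.I / ħ) = 1 := by
      field_simp; simp
    rw [this, one_smul]
  obtain ⟨c, hc, hint⟩ := exists_integral_cexp_quadratic hA hApos
  refine ⟨((2 * Real.pi * ħ * Complex.I : ℂ) ^ ((d : ℂ) / 2))⁻¹ * c, ?_, fun w f f' hf hf' => ?_⟩
  -- Only the square of the factor is constrained, so the branch of the complex power plays no role.
  · have h1 : ((2 * Real.pi * ħ * Complex.I : ℂ) ^ ((d : ℂ) / 2)) ^ 2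
        = (2 * Real.pi * ħ * Complex.I : ℂ) ^ d := by
      rw [← Complex.cpow_nat_mul, ← Complex.cpow_natCast]
      congr 1
      push_cast
      ring
    have h2 : (2 * Real.pi * ħ * Complex.I : ℂ) ^ d * (-(Complex.I / ħ)) ^ d
        = (2 * Real.pi) ^ d := by
      rw [← mul_pow]
      congr 1
      field_simp
      simp
    have hdet : A.det * Q.det = (-(Complex.I / ħ)) ^ d * Q'.det := by
      simp only [A]
      rw [det_smul, Fintype.card_fin, mul_assoc, ← det_mul,
        Matrix.nonsing_inv_mul_cancel_right _ _ hQ]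
    have hz : (2 * Real.pi * ħ * Complex.I : ℂ) ^ d ≠ 0 := by
      simp [Real.pi_ne_zero, hħ0]
    have hy : (-(Complex.I / ħ) : ℂ) ^ d ≠ 0 := by
      simp [hħ0]
    rw [mul_pow, inv_pow, h1]
    refine mul_left_cancel₀ (mul_ne_zero hz hy) ?_
    calc _ = c ^ 2 * ((-(Complex.I / ħ)) ^ d * Q'.det) := by field_simp
      _ = _ := by rw [← hdet, ← mul_assoc, hc, h2]
  · apply Lp.ext
    filter_upwards [coeFn_opJ hħ f, f'.coeFn_toLp 2 volume,
      Lp.coeFn_smul (((2 * Real.pi * ħ * Complex.I : ℂ) ^ ((d : ℂ) / 2))⁻¹ * c) (f'.toLp 2)]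
      with x h1 h2 h3
    rw [h1, h3, Pi.smul_apply, smul_eq_mul, h2, mul_assoc _ c]
    congr 1
    -- The part of the exponent linear in `y`: one term from the generating function, one from the
    -- Fourier kernel. In `bᵀA⁻¹b / 2` the `x`-`x` term is the new quadratic form, the cross terms
    -- are the new linear term, and the `w`-`w` term is the correction in `inv_mul_conj_sub`.
    set b : Fin d → ℂ := (2 / (√ħ : ℂ)) • ((Q⁻¹)ᵀ *ᵥ w) - (Complex.I / ħ) • cvec x with hb
    have e1 : ∀ y : Space d, Complex.exp (((-(1 / ħ * inner ℝ x y) : ℝ) : ℂ) * Complex.I) * f y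
        = ((((Real.pi * ħ) ^ ((d : ℝ) / 4))⁻¹ : ℝ) : ℂ)
          * Complex.exp (-(w ⬝ᵥ ((Q⁻¹ * Q.map (starRingEnd ℂ)) *ᵥ w)))
          * Complex.exp (-(1 / 2) * (cvec y ⬝ᵥ (A *ᵥ cvec y)) + b ⬝ᵥ cvec y) := by
      intro y
      rw [hf, gaussianGen, mul_left_comm, mul_assoc, ← Complex.exp_add, ← Complex.exp_add]
      congr 2
      simp only [A, hb, sub_dotProduct, smul_dotProduct, smul_mulVec, dotProduct_smul, smul_eq_mul,
        mulVec_dotProduct_eq, transpose_transpose, cvec_dotProduct_cvec]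
      push_cast
      ring
    simp only [e1]
    rw [integral_const_mul, hint, hf', gaussianGen, mul_left_comm c, mul_assoc,
      mul_left_comm _ c, ← Complex.exp_add]
    congr 3
    have hF : (Q * Q'⁻¹).IsSymm := by
      have := h.rotate.mul_inv_isSymm
      rwa [Matrix.neg_mul, IsSymm, transpose_neg, neg_inj] at this
    have q1 : ((Q⁻¹)ᵀ *ᵥ w) ⬝ᵥ ((Q * Q'⁻¹) *ᵥ ((Q⁻¹)ᵀ *ᵥ w))
        = w ⬝ᵥ ((Q'⁻¹ * (Q⁻¹)ᵀ) *ᵥ w) := by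
      rw [mulVec_dotProduct_eq, transpose_transpose, mulVec_mulVec, mulVec_mulVec,
        Matrix.nonsing_inv_mul_cancel_left _ _ hQ]
    have q2 : ((Q⁻¹)ᵀ *ᵥ w) ⬝ᵥ ((Q * Q'⁻¹) *ᵥ cvec x) = w ⬝ᵥ (Q'⁻¹ *ᵥ cvec x) := by
      rw [mulVec_dotProduct_eq, transpose_transpose, mulVec_mulVec,
        Matrix.nonsing_inv_mul_cancel_left _ _ hQ]
    have q3 : cvec x ⬝ᵥ ((Q * Q'⁻¹) *ᵥ ((Q⁻¹)ᵀ *ᵥ w)) = w ⬝ᵥ (Q'⁻¹ *ᵥ cvec x) := by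
      rw [dotProduct_comm, mulVec_dotProduct_eq, hF.eq, q2]
    rw [hAinv, h.inv_mul_conj_sub, hb]
    simp only [smul_mulVec, mulVec_sub, sub_mulVec, mulVec_smul, dotProduct_sub, sub_dotProduct,
      dotProduct_smul, smul_dotProduct, q1, q2, q3, Matrix.neg_mul, neg_mulVec, dotProduct_neg,
      smul_eq_mul]
    have hs : (ħ : ℂ) = (√ħ : ℂ) ^ 2 := by
      rw [← Complex.ofReal_pow, Real.sq_sqrt hħ.le]
    have hs0 : (√ħ : ℂ) ≠ 0 := by
      intro h0; rw [h0] at hs; simp [hħ0] at hs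
    rw [hs]
    generalize (√ħ : ℂ) = s at hs0
    have hI := Complex.I_sq
    field_simp
    ring_nf
    simp only [hI, Complex.I_pow_three]
    ring

/-- Induction over the graph, rather than over the operator group alone, keeps each operator paired
with its symplectic matrix. -/
theorem mapsGaussians_of_isMetaplecticLift {ħ : ℝ} (hħ : 0 < ħ) {U : UnitaryOp d}
    {S : symplecticGroup (Fin d) ℝ} (hU : IsMetaplecticLift hħ U S) : MapsGaussians ħ U S := by
  refine Subgroup.closure_induction (p := fun g _ => MapsGaussians ħ g.1 g.2) ?_
    ?_ ?_ ?_ hU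
  rotate_left
  · rw [Prod.fst_one, Prod.snd_one]
    exact MapsGaussians.one
  · intro g g' _ _ h h'
    rw [Prod.fst_mul, Prod.snd_mul]
    exact MapsGaussians.mul hħ h h'
  · intro g _ h
    rw [Prod.fst_inv, Prod.snd_inv]
    exact MapsGaussians.inv h
  rintro g ((⟨hg, hT⟩ | ⟨R, -, hg, hT⟩) | ⟨L, m, hm, hg, hT⟩)
  · rw [hg]; exact mapsGaussians_opJ hħ hT
  · rw [hg]; exact mapsGaussians_opV ħ hT
  · rw [hg]; exact mapsGaussians_opM ħ hm hT

theorem isFrame_one : IsFrame (1 : Matrix (Fin d) (Fin d) ℂ) (Complex.I • 1) where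
  symm := by simp
  normalized := by
    simp only [conjTranspose_one, Matrix.one_mul, conjTranspose_smul, Matrix.mul_one]
    ext i j
    simp
    ring

theorem gaussianGen_one {ħ : ℝ} (w : Fin d → ℂ) :
    gaussianGen ħ 1 (Complex.I • 1) w = hermiteGen ħ w := by
  funext x
  rw [gaussianGen, hermiteGen]
  congr 2
  have h1 : cvec x ⬝ᵥ cvec x = (‖x‖ : ℂ) ^ 2 := by
    rw [cvec_dotProduct_cvec, real_inner_self_eq_norm_sq, Complex.ofReal_pow]
  rw [inv_one, Matrix.mul_one, smul_mulVec, one_mulVec, dotProduct_smul, h1,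
    Matrix.map_one _ (map_zero _) (map_one _), Matrix.mul_one, one_mulVec, smul_eq_mul]
  field_simp
  simp [neg_div]

theorem fromRows_eq_symplectic_mul {S : symplecticGroup (Fin d) ℝ}
    {Q P : Matrix (Fin d) (Fin d) ℂ}
    (hS : S.1 = fromBlocks (Q.map Complex.re) (Q.map Complex.im)
      (P.map Complex.re) (P.map Complex.im)) :
    fromRows Q P = S.1.map Complex.ofReal * fromRows (1 : Matrix (Fin d) (Fin d) ℂ)
      (Complex.I • 1 : Matrix (Fin d) (Fin d) ℂ) := by
  rw [hS, fromBlocks_map, fromBlocks_mul_fromRows]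
  congr 1 <;>
  · ext i j
    simp [mul_comm Complex.I]

/-- A metaplectic lift of the symplectic matrix with blocks `Re Q`, `Im Q`, `Re P`, `Im P` maps the
generating function of the Hermite functions to the one of the frame `(Q, P)`. -/
theorem exists_metaplectic_hermiteGen {ħ : ℝ} (hħ : 0 < ħ) {S : symplecticGroup (Fin d) ℝ}
    {Q P : Matrix (Fin d) (Fin d) ℂ}
    (hS : S.1 = fromBlocks (Q.map Complex.re) (Q.map Complex.im)
      (P.map Complex.re) (P.map Complex.im)) {U : UnitaryOp d} (hU : IsMetaplecticLift hħ U S) :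
    IsFrame Q P ∧ ∃ σ : ℂ, σ ^ 2 = Q.det⁻¹ ∧ ∀ (w : Fin d → ℂ) (f : 𝓢(Space d, ℂ)),
      (∀ x, f x = gaussianGen ħ Q P w x) →
      U (memLp_hermiteGen hħ w).toLp = σ • f.toLp 2 volume := by
  have hF := isFrame_one.of_symplectic S (fromRows_eq_symplectic_mul hS)
  obtain ⟨σ, hσ, h⟩ := mapsGaussians_of_isMetaplecticLift hħ hU _ _ _ _ isFrame_one
    (fromRows_eq_symplectic_mul hS)
  refine ⟨hF, σ, ?_, fun w f hf => ?_⟩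
  · rw [det_one] at hσ
    exact eq_inv_of_mul_eq_one_left hσ
  · obtain ⟨g, hg⟩ := exists_schwartzMap_gaussianGen hħ isFrame_one w
    rw [← h w g f hg hf]
    congr 1
    refine MemLp.toLp_congr _ _ (ae_of_all _ fun x => ?_)
    rw [hg, gaussianGen_one]

/-! ### The power series of `exp(αt + βt²)` and its recursion -/

section OneVariable

variable {𝕜 : Type*} [RCLike 𝕜]

/-- The power series of `exp (α t)`. -/
def expLinear (α : 𝕜) : PowerSeries 𝕜 := PowerSeries.mk fun i => α ^ i / i.factorial

/-- The power series of `exp (β t²)`. -/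
def expSquare (β : 𝕜) : PowerSeries 𝕜 :=
  PowerSeries.mk fun i => if Even i then β ^ (i / 2) / (i / 2).factorial else 0

theorem derivative_expLinear (α : 𝕜) :
    PowerSeries.derivative 𝕜 (expLinear α) = PowerSeries.C α * expLinear α := by
  ext n
  rw [PowerSeries.coeff_derivative, PowerSeries.coeff_C_mul,
    expLinear, PowerSeries.coeff_mk, PowerSeries.coeff_mk, Nat.factorial_succ, pow_succ]
  have : (n + 1 : 𝕜) ≠ 0 := by exact_mod_cast n.succ_ne_zero
  push_cast
  field_simp

theorem derivative_expSquare (β : 𝕜) :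
    PowerSeries.derivative 𝕜 (expSquare β)
      = PowerSeries.C (2 * β) * (PowerSeries.X * expSquare β) := by
  ext n
  rw [PowerSeries.coeff_derivative, PowerSeries.coeff_C_mul]
  cases n with
  | zero => simp [expSquare]
  | succ n =>
    rw [PowerSeries.coeff_succ_X_mul, expSquare, PowerSeries.coeff_mk, PowerSeries.coeff_mk]
    by_cases h : Even n
    · obtain ⟨m, rfl⟩ := h
      have h1 : (m + m + 1 + 1) / 2 = m + 1 := by omega
      have h2 : (m + m) / 2 = m := by omega
      rw [if_pos ⟨m + 1, by ring⟩, if_pos ⟨m, rfl⟩, h1, h2, Nat.factorial_succ, pow_succ]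
      have : (m + 1 : 𝕜) ≠ 0 := by exact_mod_cast m.succ_ne_zero
      push_cast
      field_simp
      ring
    · rw [if_neg (by simpa [Nat.even_add_one] using h), if_neg h]
      simp

/-- The coefficients of the power series of `exp (α t + β t²)`. -/
def expQuadraticCoeff (α β : 𝕜) (k : ℕ) : 𝕜 := PowerSeries.coeff k (expLinear α * expSquare β)

theorem expQuadraticCoeff_zero (α β : 𝕜) : expQuadraticCoeff α β 0 = 1 := by
  simp [expQuadraticCoeff, expLinear, expSquare]

/-- The formal equation `F' = (α + 2βt)F`; comparing coefficients gives the recursion below. -/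
theorem derivative_expLinear_mul_expSquare (α β : 𝕜) :
    PowerSeries.derivative 𝕜 (expLinear α * expSquare β)
      = PowerSeries.C α * (expLinear α * expSquare β)
        + PowerSeries.C (2 * β) * (PowerSeries.X * (expLinear α * expSquare β)) := by
  rw [Derivation.leibniz, derivative_expLinear, derivative_expSquare, smul_eq_mul, smul_eq_mul]
  ring

theorem expQuadraticCoeff_one (α β : 𝕜) : expQuadraticCoeff α β 1 = α := by
  have h := congrArg (PowerSeries.coeff 0) (derivative_expLinear_mul_expSquare α β)
  rw [PowerSeries.coeff_derivative, map_add,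
    PowerSeries.coeff_C_mul, PowerSeries.coeff_C_mul] at h
  change expQuadraticCoeff α β (0 + 1) * _ = α * expQuadraticCoeff α β 0 + _ at h
  simpa [expQuadraticCoeff_zero] using h

theorem expQuadraticCoeff_add_two (α β : 𝕜) (k : ℕ) :
    (k + 2) * expQuadraticCoeff α β (k + 2)
      = α * expQuadraticCoeff α β (k + 1) + 2 * β * expQuadraticCoeff α β k := by
  have h := congrArg (PowerSeries.coeff (k + 1)) (derivative_expLinear_mul_expSquare α β)
  rw [PowerSeries.coeff_derivative, map_add,
    PowerSeries.coeff_C_mul, PowerSeries.coeff_C_mul, PowerSeries.coeff_succ_X_mul] at h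
  change expQuadraticCoeff α β (k + 2) * _ = α * expQuadraticCoeff α β (k + 1)
    + 2 * β * expQuadraticCoeff α β k at h
  rw [← h]
  push_cast
  ring

theorem hasSum_expSquare (β : 𝕜) :
    HasSum (fun i => PowerSeries.coeff i (expSquare β)) (NormedSpace.exp β) ∧
      Summable fun i => ‖PowerSeries.coeff i (expSquare β)‖ := by
  have hinj : Function.Injective fun i : ℕ => 2 * i := fun i j h => by simpa using h
  have hout : ∀ x, x ∉ Set.range (fun i : ℕ => 2 * i) → PowerSeries.coeff x (expSquare β) = 0 := by
    intro x hx
    rw [expSquare, PowerSeries.coeff_mk, if_neg]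
    rintro ⟨m, rfl⟩
    exact hx ⟨m, by ring⟩
  have hcomp : ∀ i, PowerSeries.coeff (2 * i) (expSquare β) = β ^ i / i.factorial := by
    intro i
    rw [expSquare, PowerSeries.coeff_mk, if_pos (even_two_mul i), Nat.mul_div_cancel_left i two_pos]
  constructor
  · rw [← hinj.hasSum_iff hout]
    simpa only [Function.comp_def, hcomp] using NormedSpace.expSeries_div_hasSum_exp β
  · rw [← hinj.summable_iff fun x hx => by rw [hout x hx, norm_zero]]
    simpa only [Function.comp_def, hcomp] using NormedSpace.norm_expSeries_div_summable β

/-- The Cauchy product of two absolutely convergent series, evaluated at `t = 1`. -/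
theorem hasSum_expQuadraticCoeff (α β : 𝕜) :
    HasSum (expQuadraticCoeff α β) (NormedSpace.exp (α + β)) := by
  have h1 : ∀ i, PowerSeries.coeff i (expLinear α) = α ^ i / i.factorial := fun i => by
    rw [expLinear, PowerSeries.coeff_mk]
  have hs1 : Summable fun i => ‖PowerSeries.coeff i (expLinear α)‖ := by
    simpa only [h1] using NormedSpace.norm_expSeries_div_summable α
  have ht1 : HasSum (fun i => PowerSeries.coeff i (expLinear α)) (NormedSpace.exp α) := by
    simpa only [h1] using NormedSpace.expSeries_div_hasSum_exp α
  obtain ⟨ht2, hs2⟩ := hasSum_expSquare β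
  have h := tsum_mul_tsum_eq_tsum_sum_antidiagonal_of_summable_norm hs1 hs2
  rw [ht1.tsum_eq, ht2.tsum_eq, ← NormedSpace.exp_add] at h
  rw [h]
  have hs := (summable_norm_sum_mul_antidiagonal_of_summable_norm hs1 hs2).of_norm
  have he : expQuadraticCoeff α β = fun k => ∑ kl ∈ Finset.HasAntidiagonal.antidiagonal k,
      PowerSeries.coeff kl.1 (expLinear α) * PowerSeries.coeff kl.2 (expSquare β) :=
    funext fun k => by rw [expQuadraticCoeff, PowerSeries.coeff_mul]
  rw [he]
  exact hs.hasSum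

theorem hasSum_of_recursion {α β : 𝕜} {b : ℕ → 𝕜} (h1 : b 1 = α * b 0)
    (h2 : ∀ k : ℕ, (k + 2) * b (k + 2) = α * b (k + 1) + 2 * β * b k) :
    HasSum b (b 0 * NormedSpace.exp (α + β)) := by
  have key : ∀ k, b k = b 0 * expQuadraticCoeff α β k ∧
      b (k + 1) = b 0 * expQuadraticCoeff α β (k + 1) := by
    intro k
    induction k with
    | zero => exact ⟨by simp [expQuadraticCoeff_zero], by
        rw [zero_add, h1, expQuadraticCoeff_one, mul_comm]⟩
    | succ k ih =>
      refine ⟨ih.2, ?_⟩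
      have hk : (k + 2 : 𝕜) ≠ 0 := by exact_mod_cast (k + 1).succ_ne_zero
      refine mul_left_cancel₀ hk ?_
      rw [h2, ih.1, ih.2, mul_left_comm (k + 2 : 𝕜), expQuadraticCoeff_add_two]
      ring
  have : b = fun k => b 0 * expQuadraticCoeff α β k := funext fun k => (key k).1
  rw [this]
  simp only [expQuadraticCoeff_zero, mul_one]
  exact (hasSum_expQuadraticCoeff α β).mul_left _

/-- Comparison principle: with nonnegative `α` and `β` the recursion is monotone in the earlier
terms, so `b` stays below `b 0` times its exact solution. -/
theorem summable_of_recursion_le {α β : ℝ} (hα : 0 ≤ α) (hβ : 0 ≤ β) {b : ℕ → ℝ}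
    (h0 : ∀ k, 0 ≤ b k) (h1 : b 1 ≤ α * b 0)
    (h2 : ∀ k : ℕ, (k + 2) * b (k + 2) ≤ α * b (k + 1) + 2 * β * b k) : Summable b := by
  have key : ∀ k, b k ≤ b 0 * expQuadraticCoeff α β k ∧
      b (k + 1) ≤ b 0 * expQuadraticCoeff α β (k + 1) := by
    intro k
    induction k with
    | zero => exact ⟨by simp [expQuadraticCoeff_zero], by
        rw [zero_add, expQuadraticCoeff_one, mul_comm]; exact h1⟩
    | succ k ih =>
      refine ⟨ih.2, ?_⟩
      have hk : (0 : ℝ) < k + 2 := by positivity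
      refine le_of_mul_le_mul_left ?_ hk
      rw [mul_left_comm (k + 2 : ℝ), expQuadraticCoeff_add_two]
      calc _ ≤ α * b (k + 1) + 2 * β * b k := h2 k
        _ ≤ α * (b 0 * expQuadraticCoeff α β (k + 1))
            + 2 * β * (b 0 * expQuadraticCoeff α β k) := by
          gcongr
          exacts [ih.2, ih.1]
        _ = _ := by ring
  exact .of_nonneg_of_le h0 (fun k => (key k).1)
    ((hasSum_expQuadraticCoeff α β).summable.mul_left _)

end OneVariable

/-! ### Multi-index recursions and multivariate generating functions -/

/-- `n ↦ f (n - e_j)`, with the value `0` where `n_j = 0`. -/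
def lowered {R : Type*} [Zero R] (j : Fin d) (f : (Fin d → ℕ) → R) (n : Fin d → ℕ) : R :=
  if n j = 0 then 0 else f (n - Pi.single j 1)

theorem lowered_add_single {R : Type*} [Zero R] (j : Fin d) (f : (Fin d → ℕ) → R)
    (n : Fin d → ℕ) : lowered j f (n + Pi.single j 1) = f n := by
  rw [lowered, if_neg (by simp)]
  congr 1
  exact add_tsub_cancel_right _ _

theorem sub_single_add_single {n : Fin d → ℕ} {j : Fin d} (h : n j ≠ 0) :
    n - Pi.single j 1 + Pi.single j 1 = n := by
  refine tsub_add_cancel_of_le fun i => ?_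
  by_cases hi : i = j
  · subst hi; simp; omega
  · simp [hi]

theorem sum_add_single (n : Fin d → ℕ) (j : Fin d) :
    ∑ i, (n + Pi.single j 1 : Fin d → ℕ) i = ∑ i, n i + 1 := by
  simp [Finset.sum_add_distrib]

/-- The multi-indices of degree `k`. -/
abbrev degreeFinset (d k : ℕ) : Finset (Fin d → ℕ) := Finset.piAntidiag Finset.univ k

theorem mem_degreeFinset {k : ℕ} {n : Fin d → ℕ} : n ∈ degreeFinset d k ↔ ∑ i, n i = k := by
  simp

theorem degreeFinset_zero : degreeFinset d 0 = {0} := Finset.piAntidiag_zero _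

theorem sum_lowered_zero {R : Type*} [AddCommMonoid R] (j : Fin d) (f : (Fin d → ℕ) → R) :
    ∑ n ∈ degreeFinset d 0, lowered j f n = 0 := by
  simp [lowered]

theorem sum_lowered_succ {R : Type*} [AddCommMonoid R] (j : Fin d) (f : (Fin d → ℕ) → R) (k : ℕ) :
    ∑ n ∈ degreeFinset d (k + 1), lowered j f n = ∑ n ∈ degreeFinset d k, f n := by
  symm
  refine Finset.sum_bij_ne_zero (fun n _ _ => n + Pi.single j 1) ?_ ?_ ?_ ?_
  · intro n hn _
    rw [mem_degreeFinset] at hn ⊢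
    rw [sum_add_single, hn]
  · intro n _ _ m _ _ h
    exact add_right_cancel h
  · intro n hn hne
    have hj : n j ≠ 0 := fun h => hne (by rw [lowered, if_pos h])
    have hn' := sub_single_add_single hj
    refine ⟨n - Pi.single j 1, ?_, ?_, hn'⟩
    · rw [mem_degreeFinset] at hn ⊢
      rw [← hn', sum_add_single] at hn
      omega
    · rwa [← lowered_add_single j f, hn']
  · intro n _ _
    rw [lowered_add_single]

/-- Euler's identity for homogeneous parts: the degree is `∑ n_j`, and each summand is re-indexed by
`n ↦ n + e_j`. -/
theorem degree_mul_sum {R : Type*} [CommSemiring R] (f : (Fin d → ℕ) → R) (k : ℕ) :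
    ((k + 1 : ℕ) : R) * ∑ n ∈ degreeFinset d (k + 1), f n
      = ∑ j, ∑ n ∈ degreeFinset d k, ((n j : R) + 1) * f (n + Pi.single j 1) := by
  rw [Finset.mul_sum]
  have h : ∀ n ∈ degreeFinset d (k + 1), ((k + 1 : ℕ) : R) * f n
      = ∑ j, lowered j (fun m => ((m j : R) + 1) * f (m + Pi.single j 1)) n := by
    intro n hn
    rw [← mem_degreeFinset.mp hn, Nat.cast_sum, Finset.sum_mul]
    refine Finset.sum_congr rfl fun j _ => ?_
    by_cases hj : n j = 0
    · simp [lowered, hj]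
    · have e := sub_single_add_single hj
      conv_lhs => rw [← e]
      conv_rhs => rw [← e]
      rw [lowered_add_single]
      simp
  rw [Finset.sum_congr rfl h, Finset.sum_comm]
  exact Finset.sum_congr rfl fun j _ => sum_lowered_succ j _ k

/-- This is the generating function at `w = (1, …, 1)`. The sums `b k` over degree `k` obey the
one-variable recursion with `α = ∑ u_j` and `β = -∑ M_{jk}`. The sums `s k` of norms obey the
corresponding inequality with absolute values, which gives absolute convergence and so permits
summation by degree. -/
theorem hasSum_multiIndex_of_recursion {t : (Fin d → ℕ) → ℂ} {u : Fin d → ℂ}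
    {M : Matrix (Fin d) (Fin d) ℂ}
    (ht : ∀ n j, ((n j : ℂ) + 1) * t (n + Pi.single j 1)
      = u j * t n - 2 * ∑ k, M j k * lowered k t n) :
    HasSum t (t 0 * Complex.exp (∑ j, u j - ∑ j, ∑ k, M j k)) := by
  set b : ℕ → ℂ := fun k => ∑ n ∈ degreeFinset d k, t n
  set s : ℕ → ℝ := fun k => ∑ n ∈ degreeFinset d k, ‖t n‖
  have hb : ∀ k : ℕ, ((k + 1 : ℕ) : ℂ) * b (k + 1)
      = (∑ j, u j) * b k - 2 * ∑ j, ∑ l, M j l * ∑ n ∈ degreeFinset d k, lowered l t n := by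
    intro k
    rw [degree_mul_sum, Finset.sum_mul, Finset.mul_sum, ← Finset.sum_sub_distrib]
    refine Finset.sum_congr rfl fun j _ => ?_
    rw [Finset.sum_congr rfl fun n _ => ht n j, Finset.sum_sub_distrib, ← Finset.mul_sum,
      ← Finset.mul_sum, Finset.sum_comm]
    simp only [b, Finset.mul_sum]
  have hs : ∀ k : ℕ, ((k + 1 : ℕ) : ℝ) * s (k + 1) ≤ (∑ j, ‖u j‖) * s k
      + 2 * ∑ j, ∑ l, ‖M j l‖ * ∑ n ∈ degreeFinset d k, lowered l (fun n => ‖t n‖) n := by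
    intro k
    rw [degree_mul_sum, Finset.sum_mul, Finset.mul_sum, ← Finset.sum_add_distrib]
    refine Finset.sum_le_sum fun j _ => ?_
    have h1 : ∀ n, ((n j : ℝ) + 1) * ‖t (n + Pi.single j 1)‖
        ≤ ‖u j‖ * ‖t n‖ + 2 * ∑ l, ‖M j l‖ * lowered l (fun n => ‖t n‖) n := by
      intro n
      have h2 : ((n j : ℝ) + 1) * ‖t (n + Pi.single j 1)‖
          = ‖((n j : ℂ) + 1) * t (n + Pi.single j 1)‖ := by
        rw [norm_mul]
        congr 1
        rw [← Nat.cast_add_one, ← Nat.cast_add_one, Complex.norm_natCast]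
      rw [h2, ht]
      refine (norm_sub_le _ _).trans (add_le_add (norm_mul_le _ _) ?_)
      rw [norm_mul, Complex.norm_ofNat]
      refine mul_le_mul_of_nonneg_left (norm_sum_le_of_le _ fun l _ => ?_) zero_le_two
      rw [norm_mul]
      refine le_of_eq ?_
      congr 1
      unfold lowered
      split_ifs <;> simp
    refine (Finset.sum_le_sum fun n _ => h1 n).trans (le_of_eq ?_)
    rw [Finset.sum_add_distrib, ← Finset.mul_sum, ← Finset.mul_sum, Finset.sum_comm]
    simp only [s, Finset.mul_sum]
  have hsum_s : Summable s := by
    refine summable_of_recursion_le (α := ∑ j, ‖u j‖) (β := ∑ j, ∑ l, ‖M j l‖) (by positivity)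
      (by positivity) (fun k => by positivity) ?_ fun k => ?_
    · have := hs 0
      simp only [sum_lowered_zero, mul_zero, Finset.sum_const_zero, add_zero] at this
      simpa using this
    · have := hs (k + 1)
      simp only [sum_lowered_succ] at this
      push_cast at this
      simp only [← Finset.sum_mul] at this
      calc _ = ((k : ℝ) + 1 + 1) * s (k + 1 + 1) := by ring_nf
        _ ≤ _ := this
        _ = _ := by ring
  have hnorm : Summable fun n => ‖t n‖ := by
    refine summable_of_sum_le (c := ∑' k, s k) (fun n => norm_nonneg _) fun F => ?_
    have hF : F ⊆ (F.image fun n => ∑ i, n i).biUnion (degreeFinset d) := by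
      intro n hn
      rw [Finset.mem_biUnion]
      exact ⟨_, Finset.mem_image_of_mem _ hn, mem_degreeFinset.mpr rfl⟩
    calc ∑ n ∈ F, ‖t n‖
        ≤ ∑ n ∈ (F.image fun n => ∑ i, n i).biUnion (degreeFinset d), ‖t n‖ :=
          Finset.sum_le_sum_of_subset_of_nonneg hF fun _ _ _ => norm_nonneg _
      _ = ∑ k ∈ F.image fun n => ∑ i, n i, s k := by
          refine Finset.sum_biUnion fun k _ l _ hkl => ?_
          rw [Function.onFun, Finset.disjoint_left]
          intro n hk hl
          exact hkl ((mem_degreeFinset.mp hk).symm.trans (mem_degreeFinset.mp hl))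
      _ ≤ _ := hsum_s.sum_le_tsum _ fun k _ => by positivity
  have hb' : HasSum b (t 0 * Complex.exp (∑ j, u j - ∑ j, ∑ k, M j k)) := by
    have := hasSum_of_recursion (α := ∑ j, u j) (β := -∑ j, ∑ l, M j l) (b := b) ?_ fun k => ?_
    · rw [sub_eq_add_neg, Complex.exp_eq_exp_ℂ]
      simpa [b, degreeFinset_zero] using this
    · have := hb 0
      simp only [sum_lowered_zero, mul_zero, Finset.sum_const_zero, sub_zero] at this
      simpa using this
    · have := hb (k + 1)
      simp only [sum_lowered_succ] at this
      push_cast at this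
      simp only [← Finset.sum_mul] at this
      calc _ = ((k : ℂ) + 1 + 1) * b (k + 1 + 1) := by ring_nf
        _ = _ := this
        _ = _ := by ring
  have hfib := hnorm.of_norm.hasSum.tsum_fiberwise fun n : Fin d → ℕ => ∑ i, n i
  have hfib' : (fun k => ∑' n : (fun n : Fin d → ℕ => ∑ i, n i) ⁻¹' {k}, t n) = b := by
    funext k
    have : (fun n : Fin d → ℕ => ∑ i, n i) ⁻¹' {k} = ↑(degreeFinset d k) := by
      ext n
      simp
    rw [this, Finset.tsum_subtype']
  rw [hfib'] at hfib
  rw [← hfib.unique hb']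
  exact hnorm.of_norm.hasSum

theorem multiPow_zero (w : Fin d → ℂ) : multiPow w 0 = 1 := by simp [multiPow]

theorem multiPow_add_single (w : Fin d → ℂ) (n : Fin d → ℕ) (j : Fin d) :
    multiPow w (n + Pi.single j 1) = multiPow w n * w j := by
  unfold multiPow
  simp only [Pi.add_apply, pow_add, Finset.prod_mul_distrib]
  congr 1
  rw [Finset.prod_eq_single j (fun i _ hi => by simp [hi]) (by simp)]
  simp

/-- The solution of the recursion of the multivariate Hermite polynomials has the generating
function `exp (uᵀw - wᵀMw)`. -/
theorem hasSum_multiPow_of_recursion {a : (Fin d → ℕ) → ℂ} {u : Fin d → ℂ}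
    {M : Matrix (Fin d) (Fin d) ℂ}
    (ha : ∀ n j, ((n j : ℂ) + 1) * a (n + Pi.single j 1)
      = u j * a n - 2 * ∑ k, M j k * lowered k a n) (w : Fin d → ℂ) :
    HasSum (fun n => a n * multiPow w n) (a 0 * Complex.exp (u ⬝ᵥ w - w ⬝ᵥ (M *ᵥ w))) := by
  -- Absorbing `w^n` into the coefficients replaces `u_j` by `u_j w_j` and `M_{jk}` by `w_j M_{jk}
  -- w_k`, which reduces the claim to `w = (1, …, 1)`.
  have h := hasSum_multiIndex_of_recursion (t := fun n => a n * multiPow w n)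
    (u := fun j => u j * w j) (M := Matrix.of fun j k => w j * M j k * w k) fun n j => ?_
  · rw [multiPow_zero, mul_one] at h
    have e : w ⬝ᵥ (M *ᵥ w) = ∑ j, ∑ k, (Matrix.of fun j k => w j * M j k * w k) j k := by
      simp only [dotProduct, mulVec, Finset.mul_sum, of_apply, mul_assoc]
    rw [e]
    exact h
  · have h1 : ∀ k, w k * lowered k (fun n => a n * multiPow w n) n
        = multiPow w n * lowered k a n := by
      intro k
      by_cases hk : n k = 0
      · simp [lowered, hk]
      · have e := sub_single_add_single hk
        rw [← e, lowered_add_single, lowered_add_single, multiPow_add_single]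
        ring
    have h2 : ∑ k, (Matrix.of fun j k => w j * M j k * w k) j k
        * lowered k (fun n => a n * multiPow w n) n
        = multiPow w n * w j * ∑ k, M j k * lowered k a n := by
      rw [Finset.mul_sum]
      refine Finset.sum_congr rfl fun k _ => ?_
      rw [of_apply, mul_assoc, h1]
      ring
    rw [h2, multiPow_add_single]
    linear_combination (multiPow w n * w j) * ha n j

/-! ### Ladder operators and their commutation relations -/

theorem positionOp_comm (k l : Fin d) (f : 𝓢(Space d, ℂ)) :
    positionOp k (positionOp l f) = positionOp l (positionOp k f) := by
  ext x
  simp only [positionOp_apply]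
  ring

theorem lineDerivOp_comm (v w : Space d) (f : 𝓢(Space d, ℂ)) :
    LineDeriv.lineDerivOp v (LineDeriv.lineDerivOp w f)
      = LineDeriv.lineDerivOp w (LineDeriv.lineDerivOp v f) := by
  have key : ∀ (v w x : Space d), LineDeriv.lineDerivOp v (LineDeriv.lineDerivOp w f) x
      = fderiv ℝ (fderiv ℝ f) x v w := by
    intro v w x
    have h : ⇑(LineDeriv.lineDerivOp w f) = fun y => fderiv ℝ f y w :=
      funext fun y => SchwartzMap.lineDerivOp_apply_eq_fderiv w f y
    have hd : DifferentiableAt ℝ (fderiv ℝ f) x :=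
      (((f.smooth 2).fderiv_right (m := 1) (by norm_num)).differentiable (by norm_num)) x
    rw [SchwartzMap.lineDerivOp_apply_eq_fderiv, h, fderiv_clm_apply hd (by fun_prop)]
    simp
  ext x
  rw [key, key]
  have hs : IsSymmSndFDerivAt ℝ f x :=
    (f.smooth 2).contDiffAt.isSymmSndFDerivAt (by simp)
  exact hs v w

theorem momentumOp_comm (ħ : ℝ) (k l : Fin d) (f : 𝓢(Space d, ℂ)) :
    momentumOp ħ k (momentumOp ħ l f) = momentumOp ħ l (momentumOp ħ k f) := by
  have h : ∀ (k : Fin d) (f : 𝓢(Space d, ℂ)), momentumOp ħ k f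
      = (-(Complex.I * ħ)) • LineDeriv.lineDerivOpCLM ℂ 𝓢(Space d, ℂ)
        (EuclideanSpace.single k (1 : ℝ)) f := fun _ _ => rfl
  rw [h k, h l, h k, h l, map_smul, map_smul]
  congr 2
  exact lineDerivOp_comm _ _ f

theorem momentumOp_positionOp (ħ : ℝ) (k l : Fin d) (f : 𝓢(Space d, ℂ)) :
    momentumOp ħ k (positionOp l f)
      = positionOp l (momentumOp ħ k f) - (if k = l then Complex.I * ħ else 0) • f := by
  ext x
  have h1 : ⇑(positionOp l f) = (fun y : Space d => (y l : ℂ)) * ⇑f :=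
    funext fun y => positionOp_apply l f y
  have h2 : HasFDerivAt (fun y : Space d => (y l : ℂ))
      (Complex.ofRealCLM.comp (EuclideanSpace.proj l : Space d →L[ℝ] ℝ)) x :=
    (Complex.ofRealCLM.comp (EuclideanSpace.proj l : Space d →L[ℝ] ℝ)).hasFDerivAt
  have h3 : lineDeriv ℝ (positionOp l f) x (EuclideanSpace.single k (1 : ℝ))
      = (x l : ℂ) * lineDeriv ℝ f x (EuclideanSpace.single k (1 : ℝ))
        + f x * (if k = l then 1 else 0) := by
    rw [h1, (h2.mul (f.hasFDerivAt x)).differentiableAt.lineDeriv_eq_fderiv,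
      (h2.mul (f.hasFDerivAt x)).fderiv, (f.hasFDerivAt x).differentiableAt.lineDeriv_eq_fderiv]
    by_cases h : k = l
    · simp [h]
    · simp [h, Ne.symm h]
  change _ = positionOp l (momentumOp ħ k f) x - (if k = l then Complex.I * ħ else 0) * f x
  rw [positionOp_apply, momentumOp_apply, momentumOp_apply, h3]
  split_ifs <;> ring

/-- The operator `∑ₖ aₖ (xₖ - qₖ) - bₖ (p̂ₖ - pₖ)`. -/
def phaseSpaceOp (ħ : ℝ) (q p : Space d) (a b : Fin d → ℂ) :
    𝓢(Space d, ℂ) →L[ℂ] 𝓢(Space d, ℂ) :=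
  ∑ k, (a k • (positionOp k - (q k : ℂ) • 1) - b k • (momentumOp ħ k - (p k : ℂ) • 1))

theorem phaseSpaceOp_eq_sum (ħ : ℝ) (q p : Space d) (a b : Fin d → ℂ) (f : 𝓢(Space d, ℂ)) :
    phaseSpaceOp ħ q p a b f = ∑ k, (a k • (positionOp k f - (q k : ℂ) • f)
      - b k • (momentumOp ħ k f - (p k : ℂ) • f)) := by
  rw [phaseSpaceOp, _root_.sum_apply]
  rfl

/-- By bilinearity only the commutators of momentum with position survive; the shifts by `q` and `p`
are scalars and drop out. -/
theorem phaseSpaceOp_comm (ħ : ℝ) (q p : Space d) (a b a' b' : Fin d → ℂ) (f : 𝓢(Space d, ℂ)) :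
    phaseSpaceOp ħ q p a b (phaseSpaceOp ħ q p a' b' f)
      = phaseSpaceOp ħ q p a' b' (phaseSpaceOp ħ q p a b f)
        + (Complex.I * ħ * (b ⬝ᵥ a' - a ⬝ᵥ b')) • f := by
  have h1 : (Complex.I * ħ * (b ⬝ᵥ a' - a ⬝ᵥ b')) • f = ∑ k, ∑ l,
      ((if k = l then Complex.I * ħ else 0) * (b k * a' l - a k * b' l)) • f := by
    rw [dotProduct, dotProduct, ← Finset.sum_sub_distrib, Finset.mul_sum, Finset.sum_smul]
    simp [ite_mul, ite_smul]
  have h2 : ∀ (a b a' b' : Fin d → ℂ), phaseSpaceOp ħ q p a b (phaseSpaceOp ħ q p a' b' f)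
      = ∑ k, ∑ l, (a k • (positionOp k (a' l • (positionOp l f - (q l : ℂ) • f)
          - b' l • (momentumOp ħ l f - (p l : ℂ) • f))
        - (q k : ℂ) • (a' l • (positionOp l f - (q l : ℂ) • f)
          - b' l • (momentumOp ħ l f - (p l : ℂ) • f)))
        - b k • (momentumOp ħ k (a' l • (positionOp l f - (q l : ℂ) • f)
          - b' l • (momentumOp ħ l f - (p l : ℂ) • f))
        - (p k : ℂ) • (a' l • (positionOp l f - (q l : ℂ) • f)
          - b' l • (momentumOp ħ l f - (p l : ℂ) • f)))) := by
    intro a b a' b'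
    rw [phaseSpaceOp_eq_sum ħ q p a' b', map_sum, Finset.sum_comm]
    exact Finset.sum_congr rfl fun l _ => phaseSpaceOp_eq_sum ħ q p a b _
  rw [h2, h2, h1, Finset.sum_comm (γ := Fin d) (f := fun k l => a' k • _ - _),
    ← Finset.sum_add_distrib]
  refine Finset.sum_congr rfl fun k _ => ?_
  rw [← Finset.sum_add_distrib]
  refine Finset.sum_congr rfl fun l _ => ?_
  simp only [map_sub, map_smul, positionOp_comm l k, momentumOp_comm ħ l k,
    momentumOp_positionOp, eq_comm (a := l) (b := k)]
  module

theorem phaseSpaceOp_apply (ħ : ℝ) (q p : Space d) (a b : Fin d → ℂ) (f : 𝓢(Space d, ℂ))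
    (x : Space d) : phaseSpaceOp ħ q p a b f x
      = (a ⬝ᵥ cvec (x - q)) * f x - ∑ k, b k * (momentumOp ħ k f x - p k * f x) := by
  rw [phaseSpaceOp_eq_sum, _root_.sum_apply, dotProduct, Finset.sum_mul, ← Finset.sum_sub_distrib]
  refine Finset.sum_congr rfl fun k _ => ?_
  change a k * (positionOp k f x - q k * f x) - b k * (momentumOp ħ k f x - p k * f x) = _
  rw [positionOp_apply]
  simp only [cvec, PiLp.sub_apply, Complex.ofReal_sub]
  ring

theorem raisingOp_eq (ħ : ℝ) (Q P : Matrix (Fin d) (Fin d) ℂ) (q p : Space d) (j : Fin d) :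
    raisingOp ħ Q P q p j
      = (Complex.I / (√(2 * ħ) : ℂ)) • phaseSpaceOp ħ q p (fun k => Pᴴ j k) (fun k => Qᴴ j k) := rfl

/-- The lowering operator `-i (2ħ)^(-1/2) [Pᵀ (x - q) - Qᵀ (p̂ - p)]_j`. -/
def loweringOp (ħ : ℝ) (Q P : Matrix (Fin d) (Fin d) ℂ) (q p : Space d) (j : Fin d) :
    𝓢(Space d, ℂ) →L[ℂ] 𝓢(Space d, ℂ) :=
  (-(Complex.I / (√(2 * ħ) : ℂ))) • phaseSpaceOp ħ q p (fun k => Pᵀ j k) (fun k => Qᵀ j k)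

theorem sqrt_two_mul_sq {ħ : ℝ} (hħ : 0 < ħ) : ((√(2 * ħ) : ℝ) : ℂ) ^ 2 = 2 * ħ := by
  rw [← Complex.ofReal_pow, Real.sq_sqrt (by positivity)]
  push_cast
  rfl

/-- The scalar commutator is an entry of the conjugate of `QᵀP - PᵀQ = 0`. -/
theorem raisingOp_comm {ħ : ℝ} {Q P : Matrix (Fin d) (Fin d) ℂ} (h : IsFrame Q P)
    (q p : Space d) (j k : Fin d) (f : 𝓢(Space d, ℂ)) :
    raisingOp ħ Q P q p j (raisingOp ħ Q P q p k f)
      = raisingOp ħ Q P q p k (raisingOp ħ Q P q p j f) := by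
  have h1 : (fun l => Qᴴ j l) ⬝ᵥ (fun l => Pᴴ k l) - (fun l => Pᴴ j l) ⬝ᵥ (fun l => Qᴴ k l) = 0 := by
    have := congrArg star (congrFun (congrFun h.symm j) k)
    rw [Matrix.mul_apply, Matrix.mul_apply, star_sum, star_sum] at this
    simp only [star_mul', transpose_apply] at this
    exact sub_eq_zero.mpr this
  simp only [raisingOp_eq, _root_.smul_apply, map_smul]
  rw [phaseSpaceOp_comm, h1, mul_zero, zero_smul, add_zero]

/-- The normalization `PᵀQ̄ - QᵀP̄ = 2i` makes the scalar commutator a Kronecker delta. -/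
theorem loweringOp_raisingOp {ħ : ℝ} (hħ : 0 < ħ) {Q P : Matrix (Fin d) (Fin d) ℂ}
    (h : IsFrame Q P) (q p : Space d) (j k : Fin d) (f : 𝓢(Space d, ℂ)) :
    loweringOp ħ Q P q p j (raisingOp ħ Q P q p k f)
      = raisingOp ħ Q P q p k (loweringOp ħ Q P q p j f) + (if j = k then (1 : ℂ) else 0) • f := by
  have h1 : (fun l => Pᵀ j l) ⬝ᵥ (fun l => Qᴴ k l) - (fun l => Qᵀ j l) ⬝ᵥ (fun l => Pᴴ k l)
      = 2 * Complex.I * if j = k then 1 else 0 := by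
    have := congrFun (congrFun h.normalized_conj j) k
    rw [Matrix.smul_apply, Matrix.one_apply, smul_eq_mul] at this
    exact this
  have h2 : (fun l => Qᵀ j l) ⬝ᵥ (fun l => Pᴴ k l) - (fun l => Pᵀ j l) ⬝ᵥ (fun l => Qᴴ k l)
      = -(2 * Complex.I * if j = k then 1 else 0) := by
    rw [← h1]; ring
  have h3 := sqrt_two_mul_sq hħ
  have hħ0 : (ħ : ℂ) ≠ 0 := by exact_mod_cast hħ.ne'
  have h4 : (Complex.I / (√(2 * ħ) : ℂ)) ^ 2 = -1 / (2 * ħ) := by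
    rw [div_pow, h3, Complex.I_sq]
  simp only [raisingOp_eq, loweringOp, _root_.smul_apply, map_smul]
  rw [phaseSpaceOp_comm, h2, smul_add, smul_add, smul_smul, smul_smul, smul_smul, smul_smul]
  congr 1
  · rw [mul_comm]
  · congr 1
    generalize (if j = k then (1 : ℂ) else 0) = δ
    calc _ = (Complex.I / (√(2 * ħ) : ℂ)) ^ 2 * (Complex.I ^ 2 * (2 * ħ * δ)) := by ring
      _ = δ := by rw [h4, Complex.I_sq]; field_simp

/-- The raising operators are multiplication operators up to lowering operators. -/
theorem raisingOp_add_loweringOp {ħ : ℝ} (hħ : 0 < ħ) {Q P : Matrix (Fin d) (Fin d) ℂ}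
    (h : IsFrame Q P) (q p : Space d) (j : Fin d) (f : 𝓢(Space d, ℂ)) (x : Space d) :
    (√2 : ℝ) * raisingOp ħ Q P q p j f x
      = ((2 / (√ħ : ℂ)) • (Q⁻¹ *ᵥ cvec (x - q))) j * f x
        - (√2 : ℝ) * ∑ k, (Q⁻¹ * Q.map (starRingEnd ℂ)) j k * loweringOp ħ Q P q p k f x := by
  set M := Q⁻¹ * Q.map (starRingEnd ℂ) with hM
  have hQ := h.isUnit_det
  have hQt : IsUnit (Qᵀ).det := by rwa [det_transpose]
  have hMs : Mᵀ = M := h.inv_mul_conj_isSymm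
  -- In `A^* + M A` the momentum parts cancel because `MQᵀ = Q^*`; by `hMP` the position parts leave
  -- a multiple of `Q⁻¹(x - q)`.
  have hMQ : M * Qᵀ = Qᴴ := by
    rw [← hMs, ← transpose_mul, hM, Matrix.mul_nonsing_inv_cancel_left _ _ hQ]
    rfl
  have hMP : Pᴴ - M * Pᵀ = (-(2 * Complex.I)) • Q⁻¹ := by
    have e1 : Pᵀ = Qᵀ * P * Q⁻¹ := by rw [h.symm, Matrix.mul_nonsing_inv_cancel_right _ _ hQ]
    have e2 : Pᴴ = (Pᴴ * Q) * Q⁻¹ := by rw [Matrix.mul_nonsing_inv_cancel_right _ _ hQ]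
    calc Pᴴ - M * Pᵀ = (Pᴴ * Q) * Q⁻¹ - (M * Qᵀ) * P * Q⁻¹ := by
          rw [← e2, e1]; simp only [Matrix.mul_assoc]
      _ = -(Qᴴ * P - Pᴴ * Q) * Q⁻¹ := by rw [hMQ, neg_sub, Matrix.sub_mul]
      _ = _ := by rw [h.normalized]; simp
  have hPh : Pᴴ = M * Pᵀ + (-(2 * Complex.I)) • Q⁻¹ := by rw [← hMP]; abel
  clear_value M
  set E : Fin d → ℂ := fun l => momentumOp ħ l f x - p l * f x
  set c : ℂ := Complex.I / (√(2 * ħ) : ℂ) with hc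
  have hr : raisingOp ħ Q P q p j f x
      = c * ((Pᴴ *ᵥ cvec (x - q)) j * f x - (Qᴴ *ᵥ E) j) := by
    rw [raisingOp_eq]
    exact congrArg (c * ·) (phaseSpaceOp_apply ħ q p _ _ f x)
  have hl : ∀ k, loweringOp ħ Q P q p k f x
      = -c * ((Pᵀ *ᵥ cvec (x - q)) k * f x - (Qᵀ *ᵥ E) k) := fun k =>
    congrArg (-c * ·) (phaseSpaceOp_apply ħ q p _ _ f x)
  have hs : ∑ k, M j k * loweringOp ħ Q P q p k f x
      = -c * (((M * Pᵀ) *ᵥ cvec (x - q)) j * f x - (Qᴴ *ᵥ E) j) := by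
    rw [← hMQ, ← mulVec_mulVec, ← mulVec_mulVec]
    change _ = -c * ((∑ k, M j k * (Pᵀ *ᵥ cvec (x - q)) k) * f x - ∑ k, M j k * (Qᵀ *ᵥ E) k)
    rw [Finset.sum_mul, ← Finset.sum_sub_distrib, Finset.mul_sum]
    exact Finset.sum_congr rfl fun k _ => by rw [hl]; ring
  have hconst : (√2 : ℝ) * c * (-(2 * Complex.I)) = 2 / (√ħ : ℂ) := by
    have h2 : ((√2 : ℝ) : ℂ) ≠ 0 := by simp
    have h3 : ((√ħ : ℝ) : ℂ) ≠ 0 := by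
      rw [Complex.ofReal_ne_zero]; exact (Real.sqrt_pos.mpr hħ).ne'
    rw [hc, Real.sqrt_mul zero_le_two, Complex.ofReal_mul]
    field_simp
    simp
  rw [hr, hs, hPh, add_mulVec, smul_mulVec, Pi.add_apply, Pi.smul_apply, Pi.smul_apply, ← hconst,
    smul_eq_mul, smul_eq_mul]
  ring

/-- The lowering operators annihilate the Gaussian of the frame. -/
theorem loweringOp_ground {ħ : ℝ} (hħ : 0 < ħ) {Q P : Matrix (Fin d) (Fin d) ℂ}
    (h : IsFrame Q P) (q p : Space d) (σ : ℂ) {f : 𝓢(Space d, ℂ)}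
    (hf : ∀ x, f x = groundFormula ħ Q P q p σ x) (k : Fin d) :
    loweringOp ħ Q P q p k f = 0 := by
  have hħ0 : (ħ : ℂ) ≠ 0 := by exact_mod_cast hħ.ne'
  ext x
  set B := P * Q⁻¹ with hB
  -- The logarithmic derivative of the Gaussian: `p̂ - p` acts on it as multiplication by `B(x -
  -- q)`. Annihilation then amounts to `QᵀB = Pᵀ`.
  have hmom : ∀ l, momentumOp ħ l f x - p l * f x = (B *ᵥ cvec (x - q)) l * f x := by
    intro l
    have hline : HasLineDerivAt ℝ (fun y : Space d => Complex.I / ħ * (1 / 2 *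
        (cvec (y - q) ⬝ᵥ (B *ᵥ cvec (y - q))) + (inner ℝ p (y - q) : ℝ)))
        (Complex.I / ħ * ((B *ᵥ cvec (x - q)) l + p l)) x (EuclideanSpace.single l (1 : ℝ)) := by
      have ht : HasDerivAt (fun t : ℝ => (t : ℂ)) 1 0 := Complex.ofRealCLM.hasDerivAt
      have hc : ∀ t : ℝ, cvec (x + t • EuclideanSpace.single l (1 : ℝ) - q)
          = cvec (x - q) + (t : ℂ) • Pi.single l 1 := by
        intro t
        rw [add_sub_right_comm, cvec_add, cvec_smul]
        congr 2
        ext i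
        by_cases hi : i = l
        · subst hi; simp [cvec]
        · simp [cvec, hi]
      have hBs : ∀ v : Fin d → ℂ, v ⬝ᵥ (B *ᵥ Pi.single l 1) = (B *ᵥ v) l := by
        intro v
        have hBt : Bᵀ = B := h.mul_inv_isSymm
        rw [dotProduct_comm, mulVec_dotProduct_eq, hBt, single_one_dotProduct]
      have hpoly : ∀ t : ℝ, Complex.I / ħ * (1 / 2 *
          (cvec (x + t • EuclideanSpace.single l (1 : ℝ) - q)
            ⬝ᵥ (B *ᵥ cvec (x + t • EuclideanSpace.single l (1 : ℝ) - q)))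
            + (inner ℝ p (x + t • EuclideanSpace.single l (1 : ℝ) - q) : ℝ))
          = Complex.I / ħ * (1 / 2 * (cvec (x - q) ⬝ᵥ (B *ᵥ cvec (x - q)))
            + (inner ℝ p (x - q) : ℝ)
            + ((t : ℂ) * ((B *ᵥ cvec (x - q)) l + p l)
              + (t : ℂ) ^ 2 * (1 / 2 * (B *ᵥ Pi.single l 1) l))) := by
        intro t
        rw [hc, mulVec_add, mulVec_smul, dotProduct_add, add_dotProduct, add_dotProduct,
          dotProduct_smul, smul_dotProduct, smul_dotProduct, dotProduct_smul, hBs,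
          hBs, single_one_dotProduct, add_sub_right_comm, inner_add_right, inner_smul_right]
        simp only [smul_eq_mul, EuclideanSpace.inner_single_right]
        push_cast
        simp only [starRingEnd_apply, star_trivial]
        ring
      unfold HasLineDerivAt
      refine HasDerivAt.congr_of_eventuallyEq ?_ (Filter.Eventually.of_forall hpoly)
      refine HasDerivAt.congr_deriv ((((ht.mul_const ((B *ᵥ cvec (x - q)) l + p l)).add
        ((ht.pow 2).mul_const (1 / 2 * (B *ᵥ Pi.single l 1) l))).const_add _).const_mul
        (Complex.I / ħ)) ?_
      simp
    have h1 : HasLineDerivAt ℝ f (f x * (Complex.I / ħ * ((B *ᵥ cvec (x - q)) l + p l))) x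
        (EuclideanSpace.single l (1 : ℝ)) := by
      have := (HasDerivAt.cexp hline).const_mul
        (σ * ((((Real.pi * ħ) ^ ((d : ℝ) / 4))⁻¹ : ℝ) : ℂ))
      have hfun : (f : Space d → ℂ) = groundFormula ħ Q P q p σ := funext hf
      rw [hfun]
      refine HasDerivAt.congr_deriv this ?_
      rw [zero_smul, add_zero, groundFormula, mul_assoc, mul_assoc, mul_assoc]
    rw [momentumOp_apply, h1.lineDeriv]
    field_simp
    linear_combination (-f x * ((B *ᵥ cvec (x - q)) l + p l)) * Complex.I_sq
  have hl : loweringOp ħ Q P q p k f x = -(Complex.I / (√(2 * ħ) : ℂ)) *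
      ((Pᵀ *ᵥ cvec (x - q)) k * f x - ∑ l, Qᵀ k l * (momentumOp ħ l f x - p l * f x)) :=
    congrArg (-(Complex.I / (√(2 * ħ) : ℂ)) * ·) (phaseSpaceOp_apply ħ q p _ _ f x)
  have hs : ∑ l, Qᵀ k l * (momentumOp ħ l f x - p l * f x)
      = (Pᵀ *ᵥ cvec (x - q)) k * f x := by
    have e : Qᵀ * B = Pᵀ := by
      rw [hB, ← Matrix.mul_assoc, h.symm, Matrix.mul_nonsing_inv_cancel_right _ _ h.isUnit_det]
    rw [← e, ← mulVec_mulVec]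
    change _ = (∑ l, Qᵀ k l * (B *ᵥ cvec (x - q)) l) * f x
    rw [Finset.sum_mul]
    exact Finset.sum_congr rfl fun l _ => by rw [hmom, mul_assoc]
  rw [hl, hs, sub_self, mul_zero]
  rfl

/-! ### The family of wave packets -/

theorem multiIndex_induction {motive : (Fin d → ℕ) → Prop} (zero : motive 0)
    (add_single : ∀ n j, motive n → motive (n + Pi.single j 1)) (n : Fin d → ℕ) : motive n := by
  induction hk : ∑ i, n i generalizing n with
  | zero =>
    have : n = 0 := by
      funext i
      exact (Finset.sum_eq_zero_iff.mp hk) i (Finset.mem_univ i)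
    exact this ▸ zero
  | succ k ih =>
    obtain ⟨j, -, hj⟩ : ∃ j ∈ Finset.univ, n j ≠ 0 := by
      by_contra! h0
      rw [Finset.sum_eq_zero h0] at hk
      omega
    have e := sub_single_add_single hj
    rw [← e]
    refine add_single _ _ (ih _ ?_)
    rw [← e, sum_add_single] at hk
    omega

/-- For `ψ_n = c_n φ_n / n!` the usual factor `√n_k` of a lowering operator becomes the constant
`√2`. The induction commutes `A_k` past `A_j^*`. -/
theorem loweringOp_family {ħ : ℝ} (hħ : 0 < ħ) {Q P : Matrix (Fin d) (Fin d) ℂ}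
    (h : IsFrame Q P) {q p : Space d} {ψ : (Fin d → ℕ) → 𝓢(Space d, ℂ)}
    (h0 : ∀ k, loweringOp ħ Q P q p k (ψ 0) = 0)
    (hψ : ∀ n j, ((n j : ℂ) + 1) • ψ (n + Pi.single j 1)
      = ((√2 : ℝ) : ℂ) • raisingOp ħ Q P q p j (ψ n)) (n : Fin d → ℕ) :
    ∀ k, loweringOp ħ Q P q p k (ψ n) = ((√2 : ℝ) : ℂ) • lowered k ψ n := by
  induction n using multiIndex_induction with
  | zero => intro k; simp [h0, lowered]
  | add_single n j ih =>
    intro k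
    have hn : ((n j : ℂ) + 1) ≠ 0 := by exact_mod_cast (n j).succ_ne_zero
    have hinj : Function.Injective fun f : 𝓢(Space d, ℂ) => ((n j : ℂ) + 1) • f :=
      smul_right_injective _ hn
    refine hinj ?_
    simp only
    rw [← map_smul, hψ, map_smul, loweringOp_raisingOp hħ h, ih, map_smul,
      smul_comm _ ((√2 : ℝ) : ℂ)]
    congr 1
    by_cases hk : n k = 0
    · by_cases hjk : j = k
      · subst hjk
        simp [lowered, hk]
      · have : (n + Pi.single j 1 : Fin d → ℕ) k = 0 := by simp [hk, Ne.symm hjk]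
        simp [lowered, hk, this, Ne.symm hjk]
    -- Raising `ψ_{n - e_k}` in direction `j` produces the factor `(n - e_k)_j + 1`. For `j = k`
    -- this is `n_j`, and the commutator supplies the missing `1`.
    · have e := sub_single_add_single hk
      set m := n - Pi.single k 1
      have e' : n + Pi.single j 1 = (m + Pi.single j 1) + Pi.single k 1 := by
        rw [← e]; exact add_right_comm _ _ _
      rw [e', lowered_add_single]
      conv_lhs => rw [← e]
      rw [lowered_add_single, ← hψ, e, ← e]
      by_cases hjk : k = j
      · subst hjk
        simp [add_smul]
      · simp [hjk, Ne.symm hjk]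

theorem multiFactorial_add_single (n : Fin d → ℕ) (j : Fin d) :
    multiFactorial (n + Pi.single j 1) = (n j + 1) * multiFactorial n := by
  unfold multiFactorial
  rw [← Finset.mul_prod_erase _ _ (Finset.mem_univ j),
    ← Finset.mul_prod_erase _ _ (Finset.mem_univ j), ← mul_assoc]
  congr 1
  · simp [Nat.factorial_succ]
  · refine Finset.prod_congr rfl fun i hi => ?_
    simp [Finset.ne_of_mem_erase hi]

theorem multiFactorial_pos (n : Fin d → ℕ) : 0 < multiFactorial n :=
  Finset.prod_pos fun _ _ => Nat.factorial_pos _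

theorem hermiteConst_zero : hermiteConst (0 : Fin d → ℕ) = 1 := by
  simp [hermiteConst, multiFactorial]

theorem hermiteConst_add_single (n : Fin d → ℕ) (j : Fin d) :
    hermiteConst (n + Pi.single j 1) = √2 * √(n j + 1) * hermiteConst n := by
  rw [hermiteConst, hermiteConst, sum_add_single, multiFactorial_add_single,
    ← Real.sqrt_mul zero_le_two, ← Real.sqrt_mul (by positivity)]
  congr 1
  push_cast
  ring

/-- Commuting operators have a family of joint normalized powers applied to a given vector. -/
theorem exists_raising_family {E : Type*} [AddCommGroup E] [Module ℂ E] (A : Fin d → Module.End ℂ E)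
    (hA : ∀ j k, Commute (A j) (A k)) (v : E) :
    ∃ φ : (Fin d → ℕ) → E, φ 0 = v ∧
      ∀ n j, φ (n + Pi.single j 1) = (((√(n j + 1 : ℝ))⁻¹ : ℝ) : ℂ) • A j (φ n) := by
  have hcomm : Pairwise fun i j => ∀ x y : Multiplicative ℕ,
      Commute (powersHom (Module.End ℂ E) (A i) x) (powersHom (Module.End ℂ E) (A j) y) :=
    fun i j _ x y => by
      rw [powersHom_apply, powersHom_apply]
      exact (hA i j).pow_pow _ _
  -- Commutativity makes `n ↦ ∏ A_j^{n_j}` a monoid homomorphism, so the recursions in the different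
  -- directions are consistent and `φ_n = (n!)^(-1/2) A^n v`.
  set Φ := MonoidHom.noncommPiCoprod (fun j => powersHom (Module.End ℂ E) (A j)) hcomm
  refine ⟨fun n => (((√(multiFactorial n : ℝ))⁻¹ : ℝ) : ℂ) •
    Φ (fun i => Multiplicative.ofAdd (n i)) v, ?_, fun n j => ?_⟩
  · change (((√(multiFactorial (0 : Fin d → ℕ) : ℝ))⁻¹ : ℝ) : ℂ) • Φ 1 v = v
    rw [map_one]
    simp [multiFactorial]
  · have h1 : (fun i => Multiplicative.ofAdd ((n + Pi.single j 1 : Fin d → ℕ) i))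
        = Pi.mulSingle j (Multiplicative.ofAdd 1) * fun i => Multiplicative.ofAdd (n i) := by
      funext i
      by_cases hi : i = j
      · subst hi
        simp [mul_comm]
      · simp [hi]
    simp only
    rw [h1, map_mul, MonoidHom.noncommPiCoprod_mulSingle, powersHom_apply, toAdd_ofAdd, pow_one,
      Module.End.mul_apply, map_smul, smul_smul, multiFactorial_add_single]
    congr 1
    push_cast
    rw [Real.sqrt_mul (by positivity), Complex.ofReal_mul, mul_inv]

/-! ### Translation in phase space and assembly of the two halves -/

theorem exists_schwartzMap_comp_sub (f : 𝓢(Space d, ℂ)) (q : Space d) :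
    ∃ g : 𝓢(Space d, ℂ), ∀ x, g x = f (x - q) :=
  ⟨SchwartzMap.compCLMOfAntilipschitz ℂ (g := fun x : Space d => x - q) (by fun_prop)
    (IsometryEquiv.subRight q).isometry.antilipschitz f, fun x => rfl⟩

theorem exists_schwartzMap_hagedornGen {ħ : ℝ} (hħ : 0 < ħ) {Q P : Matrix (Fin d) (Fin d) ℂ}
    (h : IsFrame Q P) (q p : Space d) (σ : ℂ) (w : Fin d → ℂ) :
    ∃ Γ : 𝓢(Space d, ℂ), ∀ x, Γ x = groundFormula ħ Q P q p σ x * genFactor ħ Q q w x := by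
  obtain ⟨f, hf⟩ := exists_schwartzMap_quadratic hħ h
    ((2 / (√ħ : ℂ)) • ((Q⁻¹)ᵀ *ᵥ w) + (Complex.I / ħ) • cvec p)
    (-(w ⬝ᵥ ((Q⁻¹ * Q.map (starRingEnd ℂ)) *ᵥ w)))
  obtain ⟨g, hg⟩ := exists_schwartzMap_comp_sub f q
  refine ⟨(σ * ((((Real.pi * ħ) ^ ((d : ℝ) / 4))⁻¹ : ℝ) : ℂ)) • g, fun x => ?_⟩
  rw [_root_.smul_apply, hg, hf, groundFormula, genFactor, smul_eq_mul, mul_assoc _ (Complex.exp _),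
    ← Complex.exp_add, add_dotProduct, smul_dotProduct, smul_dotProduct, mulVec_dotProduct_eq,
    transpose_transpose, cvec_dotProduct_cvec, smul_eq_mul, smul_eq_mul]
  congr 2
  ring

/-- The scalar prefactor completes the phase of `T_z`: `p·(x - q/2) - p·q/2 = p·(x - q)`. -/
theorem hagedornGen_eq {ħ : ℝ} (hħ : 0 < ħ) {Q P : Matrix (Fin d) (Fin d) ℂ} (h : IsFrame Q P)
    (q p : Space d) (σ : ℂ) (w : Fin d → ℂ) {U : UnitaryOp d}
    (hU : ∀ f : 𝓢(Space d, ℂ), (∀ x, f x = gaussianGen ħ Q P w x) →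
      U (memLp_hermiteGen hħ w).toLp = σ • f.toLp 2 volume)
    {Γ : 𝓢(Space d, ℂ)}
    (hΓ : ∀ x, Γ x = groundFormula ħ Q P q p σ x * genFactor ħ Q q w x) :
    Γ.toLp 2 volume = hagedornGen hħ q p U w := by
  obtain ⟨f, hf⟩ := exists_schwartzMap_gaussianGen hħ h w
  rw [hagedornGen, hagedornOp, hU f hf, map_smul, smul_smul]
  apply Lp.ext
  filter_upwards [Γ.coeFn_toLp 2 volume, coeFn_opT ħ q p (f.toLp 2),
    (measurePreserving_sub_right (volume : Measure (Space d)) q).quasiMeasurePreserving.ae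
      (f.coeFn_toLp 2 volume), Lp.coeFn_smul (Complex.exp (-(Complex.I / (2 * ħ))
        * (inner ℝ p q : ℝ)) * σ) (opT ħ q p (f.toLp 2 volume))] with x h1 h2 h3 h4
  rw [h1, h4, Pi.smul_apply, h2, h3, hΓ, hf, groundFormula, genFactor, gaussianGen, smul_eq_mul]
  have hħ0 : (ħ : ℂ) ≠ 0 := by exact_mod_cast hħ.ne'
  generalize ((((Real.pi * ħ) ^ ((d : ℝ) / 4))⁻¹ : ℝ) : ℂ) = N
  rw [mul_assoc _ (Complex.exp _), ← Complex.exp_add]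
  have hR : ∀ a b c : ℂ, Complex.exp a * σ * (Complex.exp b * (N * Complex.exp c))
      = σ * N * Complex.exp (a + b + c) := by
    intro a b c
    rw [Complex.exp_add, Complex.exp_add]
    ring
  rw [hR, inner_sub_right, inner_sub_right, inner_smul_right]
  congr 2
  push_cast
  field_simp
  ring

theorem genFactor_zero (ħ : ℝ) (Q : Matrix (Fin d) (Fin d) ℂ) (q x : Space d) :
    genFactor ħ Q q 0 x = 1 := by
  simp [genFactor]

theorem hagedornOp_hermiteGround {ħ : ℝ} (hħ : 0 < ħ) (q p : Space d) (U : UnitaryOp d) :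
    hagedornOp ħ q p U (memLp_hermiteGround hħ).toLp = hagedornGen hħ q p U 0 := by
  rw [hagedornGen]
  congr 1
  exact MemLp.toLp_congr _ _ (ae_of_all _ fun x => by rw [hermiteGen_zero])

theorem groundFormula_ne_zero {ħ : ℝ} (hħ : 0 < ħ) (Q P : Matrix (Fin d) (Fin d) ℂ)
    (q p : Space d) {σ : ℂ} (hσ : σ ≠ 0) (x : Space d) : groundFormula ħ Q P q p σ x ≠ 0 := by
  have : (((Real.pi * ħ) ^ ((d : ℝ) / 4))⁻¹ : ℝ) ≠ 0 := by positivity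
  exact mul_ne_zero (mul_ne_zero hσ (Complex.ofReal_ne_zero.mpr this)) (Complex.exp_ne_zero _)

theorem IsHagedornFamily.ext {ħ : ℝ} {hħ : 0 < ħ} {Q P : Matrix (Fin d) (Fin d) ℂ}
    {q p : Space d} {U : UnitaryOp d} {φ φ' : (Fin d → ℕ) → 𝓢(Space d, ℂ)}
    (h : IsHagedornFamily hħ Q P q p U φ) (h' : IsHagedornFamily hħ Q P q p U φ') : φ = φ' := by
  funext n
  induction n using multiIndex_induction with
  | zero => exact SchwartzMap.injective_toLp 2 volume (h.ground.trans h'.ground.symm)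
  | add_single n j ih => rw [h.raise, h'.raise, ih]

theorem exists_isHagedornFamily {ħ : ℝ} (hħ : 0 < ħ) {Q P : Matrix (Fin d) (Fin d) ℂ}
    (h : IsFrame Q P) (q p : Space d) (U : UnitaryOp d) {f : 𝓢(Space d, ℂ)}
    (hf : f.toLp 2 volume = hagedornOp ħ q p U (memLp_hermiteGround hħ).toLp) :
    ∃ φ, IsHagedornFamily hħ Q P q p U φ := by
  obtain ⟨φ, h0, hφ⟩ := exists_raising_family
    (fun j => (raisingOp ħ Q P q p j : 𝓢(Space d, ℂ) →ₗ[ℂ] 𝓢(Space d, ℂ)))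
    (fun j k => LinearMap.ext fun g => raisingOp_comm h q p j k g) f
  exact ⟨φ, by rw [h0, hf], hφ⟩

theorem IsHagedornFamily.hasSum {ħ : ℝ} {hħ : 0 < ħ} {Q P : Matrix (Fin d) (Fin d) ℂ}
    (h : IsFrame Q P) {q p : Space d} {U : UnitaryOp d} {φ : (Fin d → ℕ) → 𝓢(Space d, ℂ)}
    (hφ : IsHagedornFamily hħ Q P q p U φ) {σ : ℂ}
    (hσ : ∀ x, φ 0 x = groundFormula ħ Q P q p σ x) (w : Fin d → ℂ) (x : Space d) :
    HasSum (fun n : Fin d → ℕ =>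
      φ n x * ((hermiteConst n : ℂ) / (multiFactorial n : ℂ)) * multiPow w n)
      (φ 0 x * genFactor ħ Q q w x) := by
  -- This normalization removes the square roots of `n_j + 1` from the raising relation, leaving the
  -- Taylor coefficient recursion.
  set ψ : (Fin d → ℕ) → 𝓢(Space d, ℂ) :=
    fun n => ((hermiteConst n : ℂ) / (multiFactorial n : ℂ)) • φ n with hψdef
  have hψ0 : ψ 0 = φ 0 := by simp [ψ, hermiteConst_zero, multiFactorial]
  have hψ : ∀ n j, ((n j : ℂ) + 1) • ψ (n + Pi.single j 1)
      = ((√2 : ℝ) : ℂ) • raisingOp ħ Q P q p j (ψ n) := by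
    intro n j
    simp only [hψdef]
    rw [hφ.raise, map_smul, smul_smul, smul_smul, smul_smul, hermiteConst_add_single,
      multiFactorial_add_single]
    congr 1
    have h1 : ((multiFactorial n : ℕ) : ℂ) ≠ 0 := by
      exact_mod_cast (multiFactorial_pos n).ne'
    have h2 : ((√(n j + 1 : ℝ) : ℝ) : ℂ) ≠ 0 := by
      rw [Complex.ofReal_ne_zero]; positivity
    have h3 : ((n j : ℂ) + 1) ≠ 0 := by exact_mod_cast (n j).succ_ne_zero
    push_cast
    field_simp
  have hlow := loweringOp_family hħ h (q := q) (p := p)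
    (fun k => by rw [hψ0]; exact loweringOp_ground hħ h q p σ hσ k) hψ
  have hrec := hasSum_multiPow_of_recursion (a := fun n => ψ n x)
    (u := (2 / (√ħ : ℂ)) • (Q⁻¹ *ᵥ cvec (x - q)))
    (M := Q⁻¹ * Q.map (starRingEnd ℂ)) (fun n j => ?_) w
  · simp only [hψ0] at hrec
    rw [genFactor]
    convert hrec using 2
    · rename_i n
      change _ = ((hermiteConst n : ℂ) / (multiFactorial n : ℂ)) * φ n x * _
      ring
    · rw [smul_dotProduct, dotProduct_comm w (Q⁻¹ *ᵥ _), smul_eq_mul]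
  -- The recursion at the point `x`: the raising operator is replaced by multiplication minus
  -- lowering operators, and the lowering operators by their action on the family.
  · have h1 := congrArg (fun g : 𝓢(Space d, ℂ) => g x) (hψ n j)
    simp only [_root_.smul_apply, smul_eq_mul] at h1
    rw [h1, raisingOp_add_loweringOp hħ h]
    congr 1
    have h2 : (((√2 : ℝ) : ℂ)) * (√2 : ℝ) = 2 := by
      rw [← Complex.ofReal_mul, Real.mul_self_sqrt zero_le_two]; simp
    rw [Finset.mul_sum, Finset.mul_sum]
    refine Finset.sum_congr rfl fun k _ => ?_
    have h3 : lowered k (fun n => ψ n x) n = lowered k ψ n x := by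
      unfold lowered; split_ifs <;> rfl
    rw [hlow, _root_.smul_apply, smul_eq_mul, h3, ← h2]
    ring

end Hagedorn

end

theorem mainTheorem3 (d : ℕ) (ħ : ℝ) (hħ : 0 < ħ)
    (S : Matrix.symplecticGroup (Fin d) ℝ) (Q P : Matrix (Fin d) (Fin d) ℂ)
    (hS : (S : Matrix (Fin d ⊕ Fin d) (Fin d ⊕ Fin d) ℝ) =
      Matrix.fromBlocks (Q.map Complex.re) (Q.map Complex.im)
        (P.map Complex.re) (P.map Complex.im))
    (U : Hagedorn.UnitaryOp d) (hU : Hagedorn.IsMetaplecticLift hħ U S)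
    (q p : Hagedorn.Space d) :
    IsUnit Q.det ∧
    (∃! φ, Hagedorn.IsHagedornFamily hħ Q P q p U φ) ∧
    ∀ φ, Hagedorn.IsHagedornFamily hħ Q P q p U φ →
      (∃ σ : ℂ, σ ^ 2 = Q.det⁻¹ ∧
        ∀ x, φ 0 x = Hagedorn.groundFormula ħ Q P q p σ x) ∧
      (∀ x, φ 0 x ≠ 0) ∧
      ∀ w : Fin d → ℂ, ∃ Γ : SchwartzMap (Hagedorn.Space d) ℂ,
        Γ.toLp 2 MeasureTheory.volume = Hagedorn.hagedornGen hħ q p U w ∧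
        ∀ x,
          Γ x = φ 0 x * Hagedorn.genFactor ħ Q q w x ∧
          HasSum (fun n : Fin d → ℕ =>
            φ n x * ((Hagedorn.hermiteConst n : ℂ) / (Hagedorn.multiFactorial n : ℂ))
              * Hagedorn.multiPow w n) (Γ x) ∧
          Γ x / φ 0 x = Hagedorn.genFactor ħ Q q w x ∧
          HasSum (fun n : Fin d → ℕ =>
            Hagedorn.hagedornPolynomial φ n x
              * (Hagedorn.multiPow w n / (Hagedorn.multiFactorial n : ℂ))) (Γ x / φ 0 x) := by
  obtain ⟨hF, σ, hσ, hUσ⟩ := Hagedorn.exists_metaplectic_hermiteGen hħ hS hU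
  have hσ0 : σ ≠ 0 := by
    rintro rfl
    exact inv_ne_zero hF.isUnit_det.ne_zero (by rw [← hσ]; simp)
  -- The case `w = 0` of the generating function is the ground state.
  obtain ⟨f, hf⟩ := Hagedorn.exists_schwartzMap_hagedornGen hħ hF q p σ 0
  have hfL : f.toLp 2 MeasureTheory.volume
      = Hagedorn.hagedornOp ħ q p U (Hagedorn.memLp_hermiteGround hħ).toLp := by
    rw [Hagedorn.hagedornOp_hermiteGround]
    exact Hagedorn.hagedornGen_eq hħ hF q p σ 0 (hUσ 0) hf
  obtain ⟨φ₀, hφ₀⟩ := Hagedorn.exists_isHagedornFamily hħ hF q p U hfL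
  refine ⟨hF.isUnit_det, ⟨φ₀, hφ₀, fun φ hφ => hφ.ext hφ₀⟩, fun φ hφ => ?_⟩
  -- The ground state is prescribed only as an `L²` class; injectivity of the embedding of Schwartz
  -- functions makes the closed form hold at every point.
  have hφf : φ 0 = f := SchwartzMap.injective_toLp 2 MeasureTheory.volume
    (hφ.ground.trans hfL.symm)
  have hground : ∀ x, φ 0 x = Hagedorn.groundFormula ħ Q P q p σ x := fun x => by
    rw [hφf, hf, Hagedorn.genFactor_zero, mul_one]
  have hne : ∀ x, φ 0 x ≠ 0 := fun x => by
    rw [hground]; exact Hagedorn.groundFormula_ne_zero hħ Q P q p hσ0 x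
  refine ⟨⟨σ, hσ, hground⟩, hne, fun w => ?_⟩
  obtain ⟨Γ, hΓ⟩ := Hagedorn.exists_schwartzMap_hagedornGen hħ hF q p σ w
  refine ⟨Γ, Hagedorn.hagedornGen_eq hħ hF q p σ w (hUσ w) hΓ, fun x => ?_⟩
  have h1 : Γ x = φ 0 x * Hagedorn.genFactor ħ Q q w x := by rw [hΓ, hground]
  have h2 := hφ.hasSum hF hground w x
  rw [← h1] at h2
  refine ⟨h1, h2, by rw [h1, mul_div_cancel_left₀ _ (hne x)], ?_⟩
  have h3 : (fun n : Fin d → ℕ => Hagedorn.hagedornPolynomial φ n x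
      * (Hagedorn.multiPow w n / (Hagedorn.multiFactorial n : ℂ)))
      = fun n => φ n x * ((Hagedorn.hermiteConst n : ℂ) / (Hagedorn.multiFactorial n : ℂ))
        * Hagedorn.multiPow w n / φ 0 x := funext fun n => by
    unfold Hagedorn.hagedornPolynomial
    ring
  rw [h3]
  exact h2.div_const (φ 0 x)
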